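/- Let $\mathcal X$ be a standard Borel space (e.g. a Borel subset of $\mathbb R^m$), let $\mathcal A$ be a countable discrete space, and consider a discounted MDP with transition kernel $P_{x,a}\in\mathcal P(\mathcal X)$, bounded measurable reward $r:\mathcal X\times\mathcal A\to\mathbb R$ and discount factor $\gamma\in(0,1)$. A policy is a probability kernel from $\mathcal X$ to $\mathcal A$. Fix a reference policy $\pi^{\rm ref}$. For a policy $\pi$ let $\zeta^\pi_{x,a}$ be the law of $\sum_{t\ge 0}\gamma^t r(X_t,A_t)$ under $\pi$ given $X_0=x$, $A_0=a$, and let $q^\pi(x,a)$ be its mean. For $\tau>0$ and $q:\mathcal X\times\mathcal A\to\mathbb R$ put $(V_\tau q)(x)=\tau\log\int e^{q(x,a)/\tau}\,d\pi^{\rm ref}_x(a)$ and define the Boltzmann–Gibbs policy by $d(\mathrm{BG}_\tau q)_x(a)=e^{(q(x,a)-(V_\tau q)(x))/\tau}\,d\pi^{\rm ref}_x(a)$. Let $q^\star_\tau$ be the unique bounded measurable solution of $q(x,a)=r(x,a)+\gamma\int V_\tau q\,dP_{x,a}$, and let $q^\star_{\rm ref}$ be the unique bounded measurable solution of $q(x,a)=r(x,a)+\gamma\int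 \operatorname{ess\,sup}_{\pi^{\rm ref}_{x'}}q(x',\cdot)\,dP_{x,a}(x')$. A policy $\pi$ is $\varepsilon$-reference-optimal if $q^\pi\ge q^\star_{\rm ref}-\varepsilon$ everywhere. The optimality-filtered reference policy $\bar\pi^\star$ is, at each state $x$, the measure $\pi^{\rm ref}_x$ restricted to $\{a: q^\star_{\rm ref}(x,a)=\operatorname{ess\,sup}_{\pi^{\rm ref}_x}q^\star_{\rm ref}(x,\cdot)\}$ and normalized. For a policy $\pi$ and a probability kernel $\zeta$ from $\mathcal X\times\mathcal A$ to $\mathbb R$, let $(\mathcal T^\pi_\tau\zeta)_{x,a}$ be the law of $r(x,a)+\gamma Z-\gamma\tau\,\mathrm{KL}(\pi_{X'}\,\|\,\pi^{\rm ref}_{X'})$, where $X'\sim P_{x,a}$, $A'\sim\pi_{X'}$, $Z\sim\zeta_{X',A'}$. Let $(Q\zeta)(x,a)$ be the mean of $\zeta_{x,a}$ and let $\mathcal T^\star_\tau\zeta=\mathcal T_\tau^{\mathrm{BG}_\tau Q\zeta}\zeta$. With $W_p$ the $p$-Wasserstein distance on $\mathbb R$ and $\varpi\in\mathcal P(\mathcal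 X\times\mathcal A)$, put $\bar w_{p,p'}(\zeta,\zeta')=\big(\int W_p(\zeta_{x,a},\zeta'_{x,a})^{p'}\,d\varpi(x,a)\big)^{1/p'}$. Assume that there is a constant $p_{\min}>0$ such that $$\pi^{\rm ref}_x\big(\{a: q^\star_\tau(x,a)=\operatorname{ess\,sup}_{\pi^{\rm ref}_x}q^\star_\tau(x,\cdot)\}\big)\ge p_{\min}\qquad\text{for all }\tau>0,\ x\in\mathcal X.$$ Let $p,p'\in[1,\infty)$, let $\varpi\in\mathcal P(\mathcal X\times\mathcal A)$, let $\varepsilon,\delta>0$, and let $\zeta^0$ be a probability kernel from $\mathcal X\times\mathcal A$ to $\mathbb R$ with $\sup_{x,a}\int|z|^p\,d\zeta^0_{x,a}(z)<\infty$. Let $\tau\mapsto\sigma_\tau>0$ be any temperature decoupling, that is, $\sigma_\tau/\tau\to0$ as $\tau\downarrow0$. Then there are $\tau>0$ and $n_{\rm opt},n_{\rm eval}\in\mathbb N$ such that, with $\zeta^{n+1}=\mathcal T^\star_{\sigma_\tau}\zeta^n$, $\hat\pi=\mathrm{BG}_\tau Q\zeta^{n_{\rm opt}}$, $\hat\zeta^0=\zeta^{n_{\rm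 opt}}$ and $\hat\zeta^{n+1}=\mathcal T^{\hat\pi}_\tau\hat\zeta^n$, $$\bar w_{p,p'}\big(\hat\zeta^{n_{\rm eval}},\zeta^{\bar\pi^\star}\big)\le\delta\quad\text{and}\quad \mathrm{BG}_\tau Q\hat\zeta^{n_{\rm eval}}\ \text{is }\varepsilon\text{-reference-optimal}.$$ -/

import Mathlib

open MeasureTheory ProbabilityTheory Filter Topology
open scoped ENNReal

noncomputable section

/-- The `p`-Wasserstein distance between two measures on the real line, as an infimum over
couplings (it is `⊤` if there is no coupling of finite cost). -/
def wass (p : ℝ) (μ ν : Measure ℝ) : ℝ≥0∞ :=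
  (⨅ (κ : Measure (ℝ × ℝ)) (_ : κ.map Prod.fst = μ ∧ κ.map Prod.snd = ν),
    ∫⁻ z, ENNReal.ofReal (|z.1 - z.2| ^ p) ∂κ) ^ (1 / p)

/-- The averaged Wasserstein distance `(∫ W_p(ζ_y, ζ'_y)^q dϖ(y))^(1/q)` between two kernels. -/
def avgWass {Y : Type*} [MeasurableSpace Y] (p q : ℝ) (ϖ : Measure Y) (ζ ζ' : Kernel Y ℝ) :
    ℝ≥0∞ :=
  (∫⁻ y, wass p (ζ y) (ζ' y) ^ q ∂ϖ) ^ (1 / q)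

/-- Probability kernels into `ℝ` whose `p`-th absolute moments are uniformly bounded. -/
def HasBoundedMoment {Y : Type*} [MeasurableSpace Y] (p : ℝ) (ζ : Kernel Y ℝ) : Prop :=
  IsMarkovKernel ζ ∧ (⨆ y, ∫⁻ z, ENNReal.ofReal (|z| ^ p) ∂(ζ y)) < ⊤

/-- The mean function `(x, a) ↦ E_{Z ∼ ζ_{x,a}}[Z]`. -/
def meanFn {Y : Type*} [MeasurableSpace Y] (ζ : Kernel Y ℝ) (y : Y) : ℝ := ∫ z, z ∂(ζ y)

/-- Membership in `M_b`: bounded measurable real functions. -/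
def BddMeasurable {Y : Type*} [MeasurableSpace Y] (f : Y → ℝ) : Prop :=
  Measurable f ∧ ∃ C, ∀ y, |f y| ≤ C

/-- A discounted Markov decision process with states `X` and actions `A`. -/
structure MDP (X A : Type*) [MeasurableSpace X] [MeasurableSpace A] where
  /-- transition kernel -/
  P : Kernel (X × A) X
  /-- reward function -/
  r : X × A → ℝ
  /-- discount factor -/
  γ : ℝ
  markov_P : IsMarkovKernel P
  bddMeasurable_r : BddMeasurable r
  γ_pos : 0 < γ
  γ_lt_one : γ < 1

namespace MDP

variable {X A : Type*} [MeasurableSpace X] [MeasurableSpace A]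

/-- The state-action transition kernel of a policy `π`: from `(x, a)` draw `x' ∼ P_{x,a}` and then
`a' ∼ π_{x'}`. -/
def stepKernel (M : MDP X A) (π : Kernel X A) : Kernel (X × A) (X × A) :=
  M.P.compProd (Kernel.prodMkLeft (X × A) π)

theorem isMarkovKernel_stepKernel (M : MDP X A) (π : Kernel X A) [IsMarkovKernel π] :
    IsMarkovKernel (M.stepKernel π) := by
  have := M.markov_P
  unfold stepKernel
  infer_instance

/-- The transition kernel of a policy, as a kernel on histories up to time `n` that looks at the
last state-action pair only. -/
def historyKernel (M : MDP X A) (π : Kernel X A) (n : ℕ) :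
    Kernel ((_ : Finset.Iic n) → X × A) (X × A) :=
  (M.stepKernel π).comap (fun h => h ⟨n, Finset.mem_Iic.2 le_rfl⟩) (measurable_pi_apply _)

theorem isMarkovKernel_historyKernel (M : MDP X A) (π : Kernel X A) [IsMarkovKernel π] (n : ℕ) :
    IsMarkovKernel (M.historyKernel π n) := by
  have := M.isMarkovKernel_stepKernel π
  unfold historyKernel
  infer_instance

/-- The law of the state-action trajectory `(X_t, A_t)_{t ≥ 0}` under a policy `π`, given
`(X_0, A_0)`. -/
def trajectory (M : MDP X A) (π : Kernel X A) [IsMarkovKernel π] :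
    Kernel (X × A) (ℕ → X × A) :=
  haveI := M.isMarkovKernel_historyKernel π
  (Kernel.traj (X := fun _ => X × A) (M.historyKernel π) 0).comap
    (fun s _ => s) (measurable_pi_lambda _ fun _ => measurable_id)

/-- The discounted return of a trajectory. -/
def discountedReturn (M : MDP X A) (ω : ℕ → X × A) : ℝ := ∑' t : ℕ, M.γ ^ t * M.r (ω t)

open Classical in
/-- The return distribution function `ζ^π` of a policy: `ζ^π_{x,a}` is the law of
`∑ γ^t r(X_t, A_t)` given `X_0 = x`, `A_0 = a`. (Junk value `0` if `π` is not a probability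
kernel.) -/
def returnDist (M : MDP X A) (π : Kernel X A) : Kernel (X × A) ℝ :=
  if _h : IsMarkovKernel π then (M.trajectory π).map M.discountedReturn else 0

/-- The action-value function `q^π` of a policy. -/
def actionValue (M : MDP X A) (π : Kernel X A) : X × A → ℝ := meanFn (M.returnDist π)

/-- The log-partition function `(V_τ q)(x) = τ log ∫ exp(q(x,a)/τ) dπref_x(a)`. -/
def softValue (πref : Kernel X A) (τ : ℝ) (q : X × A → ℝ) (x : X) : ℝ :=
  τ * Real.log (∫ a, Real.exp (q (x, a) / τ) ∂(πref x))

/-- The Boltzmann-Gibbs policy of `q` at temperature `τ`, which has density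
`exp((q(x,a) - (V_τ q)(x))/τ)` with respect to `πref_x`. -/
def boltzmann (πref : Kernel X A) [IsMarkovKernel πref] (τ : ℝ) (q : X × A → ℝ) : Kernel X A :=
  Kernel.withDensity πref fun x a =>
    ENNReal.ofReal (Real.exp ((q (x, a) - softValue πref τ q x) / τ))

/-- The soft Bellman optimality operator at temperature `τ`. -/
def softBellman (M : MDP X A) (πref : Kernel X A) (τ : ℝ) (q : X × A → ℝ) (s : X × A) : ℝ :=
  M.r s + M.γ * ∫ x', softValue πref τ q x' ∂(M.P s)

/-- The Bellman reference-optimality operator. -/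
def refBellman (M : MDP X A) (πref : Kernel X A) (q : X × A → ℝ) (s : X × A) : ℝ :=
  M.r s + M.γ * ∫ x', essSup (fun a' => q (x', a')) (πref x') ∂(M.P s)

/-- The soft optimal action-value function `q*_τ`: the (unique) bounded measurable fixed point of
the soft Bellman optimality operator. -/
def qSoft (M : MDP X A) (πref : Kernel X A) (τ : ℝ) : X × A → ℝ :=
  Classical.epsilon fun q => BddMeasurable q ∧ M.softBellman πref τ q = q

/-- The reference-optimal action-value function: the (unique) bounded measurable fixed point of
the Bellman reference-optimality operator. -/
def qRef (M : MDP X A) (πref : Kernel X A) : X × A → ℝ :=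
  Classical.epsilon fun q => BddMeasurable q ∧ M.refBellman πref q = q

/-- The actions at `x` whose value under `q` equals the `πref_x`-essential supremum of
`q(x, ·)`. -/
def optActions (πref : Kernel X A) (q : X × A → ℝ) (x : X) : Set A :=
  {a | q (x, a) = essSup (fun a' => q (x, a')) (πref x)}

/-- A policy is `ε`-reference-optimal if `q^π ≥ q*_ref - ε` everywhere. -/
def IsRefOptimal (M : MDP X A) (πref : Kernel X A) (ε : ℝ) (π : Kernel X A) : Prop :=
  IsMarkovKernel π ∧ ∀ s, M.qRef πref s - ε ≤ M.actionValue π s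

/-- Coverage: uniformly over temperatures and states, the reference policy gives mass at least some
`c > 0` to the actions that maximize the soft optimal action-value function. -/
def Coverage (M : MDP X A) (πref : Kernel X A) : Prop :=
  ∃ c : ℝ, 0 < c ∧ ∀ τ : ℝ, 0 < τ → ∀ x,
    ENNReal.ofReal c ≤ πref x (optActions πref (M.qSoft πref τ) x)

open Classical in
/-- The reference policy filtered by `q`: `πref_x` restricted to `optActions πref q x` and
normalized. -/
def filteredPolicy (πref : Kernel X A) [IsMarkovKernel πref] (q : X × A → ℝ) : Kernel X A :=
  Kernel.withDensity πref fun x a =>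
    if a ∈ optActions πref q x then (πref x (optActions πref q x))⁻¹ else 0

/-- The optimality-filtered reference policy: the reference policy restricted, at each state, to
its reference-optimal actions. -/
def optFilteredPolicy (M : MDP X A) (πref : Kernel X A) [IsMarkovKernel πref] : Kernel X A :=
  filteredPolicy πref (M.qRef πref)

/-- The soft distributional Bellman operator of a policy `π`: the image at `(x, a)` is the law of
`r(x,a) + γ Z - γ τ KL(π_{X'} ‖ πref_{X'})`, where `X' ∼ P_{x,a}`, `A' ∼ π_{X'}` and
`Z ∼ ζ_{X',A'}`. -/
def softEval (M : MDP X A) (πref : Kernel X A) (τ : ℝ) (π : Kernel X A) (ζ : Kernel (X × A) ℝ) :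
    Kernel (X × A) ℝ :=
  (Kernel.id.compProd
      (Kernel.prodMkLeft (X × A)
        ((M.stepKernel π).compProd (Kernel.prodMkLeft (X × A) ζ)))).map
    fun w : (X × A) × ((X × A) × ℝ) =>
      M.r w.1 + M.γ * w.2.2
        - M.γ * τ * (InformationTheory.klDiv (π w.2.1.1) (πref w.2.1.1)).toReal

/-- The soft distributional optimality operator at temperature `τ`. -/
def softControl (M : MDP X A) (πref : Kernel X A) [IsMarkovKernel πref] (τ : ℝ)
    (ζ : Kernel (X × A) ℝ) : Kernel (X × A) ℝ :=
  M.softEval πref τ (boltzmann πref τ (meanFn ζ)) ζ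

/-- `n` steps of soft distributional control at temperature `σ`. -/
def controlIterate (M : MDP X A) (πref : Kernel X A) [IsMarkovKernel πref] (σ : ℝ)
    (ζ₀ : Kernel (X × A) ℝ) (n : ℕ) : Kernel (X × A) ℝ :=
  (M.softControl πref σ)^[n] ζ₀

/-- The decoupled scheme: `nOpt` steps of soft distributional control at temperature `σ`, and then
`nEval` steps, at temperature `τ`, of soft distributional evaluation of the Boltzmann-Gibbs policy
at temperature `τ` of the resulting mean. -/
def decoupledIterate (M : MDP X A) (πref : Kernel X A) [IsMarkovKernel πref] (τ σ : ℝ)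
    (ζ₀ : Kernel (X × A) ℝ) (nOpt nEval : ℕ) : Kernel (X × A) ℝ :=
  (M.softEval πref τ (boltzmann πref τ (meanFn (M.controlIterate πref σ ζ₀ nOpt))))^[nEval]
    (M.controlIterate πref σ ζ₀ nOpt)

end MDP

/-- A temperature decoupling: a positive alternate temperature `σ(τ)` with `σ(τ)/τ → 0` as
`τ → 0⁺`. -/
def IsDecoupling (σ : ℝ → ℝ) : Prop :=
  (∀ τ, 0 < τ → 0 < σ τ) ∧ Tendsto (fun τ => σ τ / τ) (𝓝[>] 0) (𝓝 0)

end

/-!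
The means of the control iterates follow the soft Bellman iteration, hence converge uniformly to
`q*_σ`. If the maximizers of `q*_σ` have mass at least `c`, then the soft and the reference value of
`q*_σ` differ by at most `σ log c⁻¹`, so `q*_σ` is within `O(σ)` of `q*_ref`; letting `σ → 0`, the
coverage passes to `q*_ref`. Now let `q` be within `η = O(σ)` of `q*_ref`. The Boltzmann-Gibbs
policy of `q` at temperature `τ` pays a relative entropy cost of at most `τ log c⁻¹ + 2η` per step
and loses at most as much value. Hence evaluating it keeps the means near `q*_ref`, which gives
reference optimality.

For the convergence of the laws, this policy dominates a multiple of the filtered policy at every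
state, and since `η / τ → 0` the factor tends to `1` as `τ → 0`. Run the filtered policy with this
factor as survival probability: on survival the two chains make the same moves, and the two returns
differ only by the discounted entropy cost and by the initial return law, whose influence after `n`
steps is `O(γⁿ)`. As `n` is fixed before `τ`, the survival probability tends to `1`. What remains
of the joint law is controlled because the return laws are, up to an `L^p`-error, supported in a
fixed interval, and dominated convergence yields the average over state-action pairs.
-/

section EssSup

variable {Ω : Type*} [MeasurableSpace Ω] {μ : Measure Ω} {f : Ω → ℝ}

theorem ae_le_essSup_of_bounded (hf : ∃ C, ∀ a, |f a| ≤ C) : ∀ᵐ a ∂μ, f a ≤ essSup f μ :=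
  ae_le_essSup (isBoundedUnder_of (hf.imp fun _ hC a => (abs_le.1 (hC a)).2))

theorem essSup_le_iff_of_bounded [NeZero μ] (hf : ∃ C, ∀ a, |f a| ≤ C) {c : ℝ} :
    essSup f μ ≤ c ↔ ∀ᵐ a ∂μ, f a ≤ c := by
  refine ⟨fun h => (ae_le_essSup_of_bounded hf).mono fun _ ha => ha.trans h, fun h => ?_⟩
  obtain ⟨C, hC⟩ := hf
  have hbelow : IsBoundedUnder (· ≥ ·) (ae μ) f :=
    isBoundedUnder_of ⟨-C, fun a => (abs_le.1 (hC a)).1⟩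
  exact essSup_le_of_ae_le c h hbelow.isCoboundedUnder_le

theorem le_measure_eq_essSup [IsFiniteMeasure μ] (hfm : Measurable f)
    (hf : ∃ C, ∀ a, |f a| ≤ C) {c : ℝ≥0∞}
    (h : ∀ e : ℝ, 0 < e → c ≤ μ {a | essSup f μ - e ≤ f a}) : c ≤ μ {a | f a = essSup f μ} := by
  set level : ℕ → Set Ω := fun n => {a | essSup f μ - 1 / ((n : ℝ) + 1) ≤ f a}
  have hinter : μ (⋂ n, level n) ≤ μ {a | f a = essSup f μ} := by
    refine measure_mono_ae ?_
    filter_upwards [ae_le_essSup_of_bounded (μ := μ) hf] with a hle ha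
    have hlim : Tendsto (fun n : ℕ => essSup f μ - 1 / ((n : ℝ) + 1)) atTop (𝓝 (essSup f μ)) := by
      simpa using tendsto_one_div_add_atTop_nhds_zero_nat.const_sub (essSup f μ)
    exact hle.antisymm (le_of_tendsto' hlim fun n => Set.mem_iInter.1 ha n)
  have hanti : Antitone level := fun m n hmn =>
    Set.ofPred_subset_ofPred.2 fun a => (sub_le_sub_left (Nat.one_div_le_one_div hmn) _).trans
  have htendsto := tendsto_measure_iInter_atTop (μ := μ)
    (fun n => (measurableSet_le measurable_const hfm : MeasurableSet (level n)).nullMeasurableSet)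
    hanti ⟨0, measure_ne_top _ _⟩
  exact (ge_of_tendsto' htendsto fun n => h _ (by positivity)).trans hinter

end EssSup

namespace BddMeasurable

variable {X Y Z : Type*} [MeasurableSpace X] [MeasurableSpace Y] [MeasurableSpace Z]

theorem const (c : ℝ) : BddMeasurable fun _ : Y => c :=
  ⟨measurable_const, |c|, fun _ => le_rfl⟩

theorem integrable {f : Y → ℝ} (hf : BddMeasurable f) (μ : Measure Y) [IsFiniteMeasure μ] :
    Integrable f μ :=
  hf.2.elim fun C hC => Integrable.of_bound hf.1.aestronglyMeasurable C (ae_of_all _ hC)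

theorem comp {f : Y → ℝ} (hf : BddMeasurable f) {g : X → Y} (hg : Measurable g) :
    BddMeasurable fun x => f (g x) :=
  ⟨hf.1.comp hg, hf.2.imp fun _ hC x => hC (g x)⟩

theorem prodMk_left {f : X × Y → ℝ} (hf : BddMeasurable f) (x : X) :
    BddMeasurable fun y => f (x, y) :=
  hf.comp measurable_prodMk_left

theorem const_mul {f : Y → ℝ} (hf : BddMeasurable f) (c : ℝ) : BddMeasurable fun y => c * f y :=
  ⟨hf.1.const_mul c, hf.2.elim fun C hC => ⟨|c| * C, fun y => by
    rw [abs_mul]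
    exact mul_le_mul_of_nonneg_left (hC y) (abs_nonneg c)⟩⟩

theorem sub {f g : Y → ℝ} (hf : BddMeasurable f) (hg : BddMeasurable g) :
    BddMeasurable fun y => f y - g y := by
  obtain ⟨⟨hfm, C, hC⟩, ⟨hgm, D, hD⟩⟩ := And.intro hf hg
  exact ⟨hfm.sub hgm, C + D, fun y => (abs_sub _ _).trans (add_le_add (hC y) (hD y))⟩

theorem integral_le_add {f g : Y → ℝ} (hf : BddMeasurable f) (hg : BddMeasurable g) {c : ℝ}
    (h : ∀ y, f y ≤ g y + c) (μ : Measure Y) [IsProbabilityMeasure μ] :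
    ∫ y, f y ∂μ ≤ ∫ y, g y ∂μ + c := by
  have hmono := integral_mono (hf.integrable μ) ((hg.integrable μ).add (integrable_const c)) h
  simpa [integral_add (hg.integrable μ) (integrable_const c)] using hmono

theorem exists_limit_of_geometric {u : ℕ → Y → ℝ} (hu : ∀ n, BddMeasurable (u n)) {K C : ℝ}
    (hK : K < 1) (hC : ∀ n y, dist (u n y) (u (n + 1) y) ≤ C * K ^ n) :
    ∃ q, BddMeasurable q ∧ ∀ n y, |u n y - q y| ≤ C * K ^ n / (1 - K) := by
  have hlim (y) : ∃ l, Tendsto (fun n => u n y) atTop (𝓝 l) :=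
    cauchySeq_tendsto_of_complete (cauchySeq_of_le_geometric K C hK fun n => hC n y)
  choose q hq using hlim
  have hnear (n y) : |u n y - q y| ≤ C * K ^ n / (1 - K) :=
    dist_le_of_le_geometric_of_tendsto K C hK (fun n => hC n y) (hq y) n
  obtain ⟨D, hD⟩ := (hu 0).2
  refine ⟨q, ⟨measurable_of_tendsto_metrizable (fun n => (hu n).1) (tendsto_pi_nhds.2 hq),
    D + C * K ^ 0 / (1 - K), fun y => ?_⟩, hnear⟩
  calc |q y| = |u 0 y - (u 0 y - q y)| := by rw [sub_sub_cancel]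
    _ ≤ |u 0 y| + |u 0 y - q y| := abs_sub _ _
    _ ≤ _ := add_le_add (hD y) (hnear 0 y)

end BddMeasurable

/-- Operators between bounded measurable functions that are `K`-Lipschitz for the sup norm. The
inequality is required for every bound `c` of the pointwise distances, which avoids suprema. -/
structure IsSupLipschitz {Y Z : Type*} [MeasurableSpace Y] [MeasurableSpace Z] (K : ℝ)
    (T : (Y → ℝ) → Z → ℝ) : Prop where
  bddMeasurable {q : Y → ℝ} (hq : BddMeasurable q) : BddMeasurable (T q)
  abs_sub_le {q q' : Y → ℝ} (hq : BddMeasurable q) (hq' : BddMeasurable q') {c : ℝ}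
    (h : ∀ y, |q y - q' y| ≤ c) (z : Z) : |T q z - T q' z| ≤ K * c

namespace IsSupLipschitz

variable {X Y Z : Type*} [MeasurableSpace X] [MeasurableSpace Y] [MeasurableSpace Z] {K L : ℝ}

theorem of_le_add {T : (Y → ℝ) → Z → ℝ} (hmeas : ∀ {q}, BddMeasurable q → Measurable (T q))
    (hzero : ∃ C, ∀ z, |T 0 z| ≤ C)
    (hle : ∀ {q q' : Y → ℝ}, BddMeasurable q → BddMeasurable q' → ∀ {c : ℝ},
      (∀ y, q y ≤ q' y + c) → ∀ z, T q z ≤ T q' z + K * c) : IsSupLipschitz K T := by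
  have habs {q q' : Y → ℝ} (hq : BddMeasurable q) (hq' : BddMeasurable q') {c : ℝ}
      (h : ∀ y, |q y - q' y| ≤ c) (z : Z) : |T q z - T q' z| ≤ K * c :=
    abs_sub_le_iff.2
      ⟨by linarith [hle hq hq' (fun y => by linarith [(abs_sub_le_iff.1 (h y)).1]) z],
        by linarith [hle hq' hq (fun y => by linarith [(abs_sub_le_iff.1 (h y)).2]) z]⟩
  refine ⟨fun {q} hq => ⟨hmeas hq, ?_⟩, habs⟩
  obtain ⟨⟨C, hC⟩, ⟨D, hD⟩⟩ := And.intro hq.2 hzero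
  refine ⟨D + K * C, fun z => ?_⟩
  have hsub := habs hq (BddMeasurable.const 0) (by simpa using hC) z
  calc |T q z| = |T 0 z + (T q z - T 0 z)| := by rw [add_sub_cancel]
    _ ≤ |T 0 z| + |T q z - T 0 z| := abs_add_le _ _
    _ ≤ D + K * C := add_le_add (hD z) hsub

theorem comp {T : (Y → ℝ) → Z → ℝ} {S : (X → ℝ) → Y → ℝ} (hT : IsSupLipschitz K T)
    (hS : IsSupLipschitz L S) : IsSupLipschitz (K * L) (T ∘ S) where
  bddMeasurable hq := hT.bddMeasurable (hS.bddMeasurable hq)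
  abs_sub_le hq hq' c h z := by
    rw [mul_assoc]
    exact hT.abs_sub_le (hS.bddMeasurable hq) (hS.bddMeasurable hq') (hS.abs_sub_le hq hq' h) z

variable {T : (Y → ℝ) → Y → ℝ} {q q' : Y → ℝ}

theorem bddMeasurable_iterate (hT : IsSupLipschitz K T) (hq : BddMeasurable q) (n : ℕ) :
    BddMeasurable (T^[n] q) :=
  Function.Iterate.rec _ hq (fun _ => hT.bddMeasurable) n

theorem abs_iterate_sub_le (hT : IsSupLipschitz K T) (hq : BddMeasurable q)
    (hq' : BddMeasurable q') {c : ℝ} (h : ∀ y, |q y - q' y| ≤ c) (n : ℕ) (y : Y) :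
    |T^[n] q y - T^[n] q' y| ≤ c * K ^ n := by
  induction n generalizing y with
  | zero => simpa using h y
  | succ n ih =>
    rw [Function.iterate_succ_apply', Function.iterate_succ_apply', pow_succ', mul_left_comm]
    exact hT.abs_sub_le (hT.bddMeasurable_iterate hq n) (hT.bddMeasurable_iterate hq' n) ih y

theorem exists_fixedPoint (hT : IsSupLipschitz K T) (hK0 : 0 ≤ K) (hK1 : K < 1) :
    ∃ q, BddMeasurable q ∧ T q = q := by
  have h0 : BddMeasurable (0 : Y → ℝ) := BddMeasurable.const 0
  have h1 := hT.bddMeasurable h0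
  obtain ⟨C, hC⟩ := (h0.sub h1).2
  obtain ⟨q, hq, hnear⟩ := BddMeasurable.exists_limit_of_geometric
    (hT.bddMeasurable_iterate h0) hK1 (hT.abs_iterate_sub_le h0 h1 hC)
  refine ⟨q, hq, funext fun y => ?_⟩
  have hrate (D : ℝ) : Tendsto (fun n : ℕ => D * (C * K ^ n / (1 - K))) atTop (𝓝 0) := by
    simpa using (((tendsto_pow_atTop_nhds_zero_of_lt_one hK0 hK1).const_mul C).div_const
      (1 - K)).const_mul D
  have hlim : Tendsto (fun n => T^[n] 0 y) atTop (𝓝 (q y)) :=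
    tendsto_iff_dist_tendsto_zero.2
      (squeeze_zero (fun _ => dist_nonneg) (fun n => hnear n y) (by simpa using hrate 1))
  refine tendsto_nhds_unique ?_ ((tendsto_add_atTop_iff_nat 1).2 hlim)
  refine tendsto_iff_dist_tendsto_zero.2 (squeeze_zero (fun _ => dist_nonneg) (fun n => ?_)
    (hrate K))
  rw [Function.iterate_succ_apply']
  exact hT.abs_sub_le (hT.bddMeasurable_iterate h0 n) hq (hnear n) y

theorem exists_iterate_near (hT : IsSupLipschitz K T) (hK0 : 0 ≤ K) (hK1 : K < 1)
    (hq : BddMeasurable q) (hq' : BddMeasurable q') (hfix : T q' = q') {e : ℝ} (he : 0 < e) :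
    ∃ n : ℕ, ∀ y, |T^[n] q y - q' y| ≤ e := by
  obtain ⟨C, hC⟩ := (hq.sub hq').2
  have hrate : Tendsto (fun n : ℕ => C * K ^ n) atTop (𝓝 0) := by
    simpa using (tendsto_pow_atTop_nhds_zero_of_lt_one hK0 hK1).const_mul C
  obtain ⟨n, hn⟩ := (hrate.eventually_le_const he).exists
  refine ⟨n, fun y => ?_⟩
  have hiter := hT.abs_iterate_sub_le hq hq' hC n y
  rw [Function.iterate_fixed hfix] at hiter
  exact hiter.trans hn

end IsSupLipschitz

theorem le_div_of_self_improving {Y : Type*} {γ b : ℝ} (hγ : γ < 1) {f : Y → ℝ}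
    (hf : ∃ C, ∀ y, f y ≤ C) (h : ∀ c, (∀ y, f y ≤ c) → ∀ y, f y ≤ b + γ * c) (y : Y) :
    f y ≤ b / (1 - γ) := by
  have : Nonempty Y := ⟨y⟩
  have hbdd : BddAbove (Set.range f) := hf.imp fun _ => Set.forall_mem_range.2
  have hsup : ⨆ y, f y ≤ b + γ * ⨆ y, f y := ciSup_le (h _ (le_ciSup hbdd))
  refine (le_ciSup hbdd y).trans ?_
  rw [le_div_iff₀ (by linarith)]
  linarith

namespace MDP

variable {X A : Type*} [MeasurableSpace X] [MeasurableSpace A]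

/-- The reference value `x ↦ ess sup_{πref_x} q(x, ·)` of an action-value function. -/
noncomputable def refValue (πref : Kernel X A) (q : X × A → ℝ) (x : X) : ℝ :=
  essSup (fun a => q (x, a)) (πref x)

/-- The value `x ↦ ∫ q(x, a) dπ_x(a)` of an action-value function when the next action is drawn
from the policy `π`. -/
noncomputable def policyValue (π : Kernel X A) (q : X × A → ℝ) (x : X) : ℝ :=
  ∫ a, q (x, a) ∂(π x)

/-- The Bellman backup `(x, a) ↦ r(x, a) + γ ∫ v dP_{x,a}` of a value function on states. -/
noncomputable def bellmanBackup (M : MDP X A) (v : X → ℝ) (s : X × A) : ℝ :=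
  M.r s + M.γ * ∫ x, v x ∂(M.P s)

/-- At every state, `πref` gives mass at least `c` to the maximizers of `q`. -/
def IsCovered (πref : Kernel X A) (c : ℝ) (q : X × A → ℝ) : Prop :=
  ∀ x, ENNReal.ofReal c ≤ πref x (optActions πref q x)

theorem policyValue_le_refValue {πref π : Kernel X A} [IsMarkovKernel π] {q : X × A → ℝ}
    (hq : BddMeasurable q) {x : X} (hac : π x ≪ πref x) :
    policyValue π q x ≤ refValue πref q x := by
  have hle := hac.ae_le (ae_le_essSup_of_bounded (hq.prodMk_left x).2)
  simpa [policyValue, refValue] using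
    integral_mono_ae ((hq.prodMk_left x).integrable (π x)) (integrable_const _) hle

section Values

variable (πref : Kernel X A) [IsMarkovKernel πref] {q q' : X × A → ℝ} {τ : ℝ}

theorem isSupLipschitz_refValue : IsSupLipschitz 1 (refValue πref) := by
  refine .of_le_add (fun {q} hq => measurable_of_Iic fun t => ?_) ⟨0, fun x => ?_⟩ ?_
  · have hpre : refValue πref q ⁻¹' Set.Iic t
        = {x | πref x (Prod.mk x ⁻¹' {s | ¬ q s ≤ t}) = 0} := by
      ext x
      exact essSup_le_iff_of_bounded (hq.prodMk_left x).2
    rw [hpre]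
    exact Kernel.measurable_kernel_prodMk_left
      (measurableSet_le hq.1 measurable_const).compl (measurableSet_singleton 0)
  · simp [refValue]
  · intro q q' hq hq' c h x
    refine (essSup_le_iff_of_bounded (hq.prodMk_left x).2).2 ?_
    filter_upwards [ae_le_essSup_of_bounded (μ := πref x) (hq'.prodMk_left x).2] with a ha
    rw [one_mul]
    exact (h (x, a)).trans (by gcongr; exact ha)

theorem isSupLipschitz_policyValue (π : Kernel X A) [IsMarkovKernel π] :
    IsSupLipschitz 1 (policyValue π) := by
  refine .of_le_add (fun {q} hq => ?_) ⟨0, fun x => by simp [policyValue]⟩ ?_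
  · exact hq.1.stronglyMeasurable.integral_kernel_prod_right'.measurable
  · intro q q' hq hq' c h x
    rw [one_mul]
    exact (hq.prodMk_left x).integral_le_add (hq'.prodMk_left x) (fun a => h (x, a)) (π x)

variable {πref}

theorem integrable_exp_div (hq : BddMeasurable q) (τ : ℝ) (x : X) (μ : Measure A)
    [IsFiniteMeasure μ] : Integrable (fun a => Real.exp (q (x, a) / τ)) μ := by
  obtain ⟨hm, C, hC⟩ := hq
  refine Integrable.of_bound (by fun_prop : Measurable _).aestronglyMeasurable
    (Real.exp (C / |τ|)) (ae_of_all _ fun a => ?_)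
  rw [Real.norm_eq_abs, Real.abs_exp, Real.exp_le_exp]
  refine (le_abs_self _).trans ?_
  rw [abs_div]
  gcongr
  exact hC _

theorem exp_softValue_div (hq : BddMeasurable q) (hτ : 0 < τ) (x : X) :
    Real.exp (softValue πref τ q x / τ) = ∫ a, Real.exp (q (x, a) / τ) ∂(πref x) := by
  rw [softValue, mul_div_cancel_left₀ _ hτ.ne',
    Real.exp_log (integral_exp_pos (integrable_exp_div hq τ x _))]

theorem softValue_le_iff (hq : BddMeasurable q) (hτ : 0 < τ) {x : X} {c : ℝ} :
    softValue πref τ q x ≤ c ↔ ∫ a, Real.exp (q (x, a) / τ) ∂(πref x) ≤ Real.exp (c / τ) := by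
  rw [← exp_softValue_div hq hτ, Real.exp_le_exp, div_le_div_iff_of_pos_right hτ]

theorem softValue_le_refValue (hq : BddMeasurable q) (hτ : 0 < τ) (x : X) :
    softValue πref τ q x ≤ refValue πref q x := by
  rw [softValue_le_iff hq hτ]
  have hle : ∀ᵐ a ∂πref x, Real.exp (q (x, a) / τ) ≤ Real.exp (refValue πref q x / τ) := by
    filter_upwards [ae_le_essSup_of_bounded (hq.prodMk_left x).2] with a ha
    gcongr
    exact ha
  simpa using integral_mono_ae (integrable_exp_div hq τ x _) (integrable_const _) hle

variable (πref) in
theorem isSupLipschitz_softValue (hτ : 0 < τ) : IsSupLipschitz 1 (softValue πref τ) := by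
  refine .of_le_add (fun {q} hq => ?_) ⟨0, fun x => by simp [softValue]⟩ ?_
  · have hm := hq.1
    have hint : StronglyMeasurable fun x => ∫ a, Real.exp (q (x, a) / τ) ∂(πref x) :=
      StronglyMeasurable.integral_kernel_prod_right' (f := fun s => Real.exp (q s / τ))
        (by fun_prop)
    exact (Real.measurable_log.comp hint.measurable).const_mul τ
  · intro q q' hq hq' c h x
    rw [one_mul, softValue_le_iff hq hτ, add_div, Real.exp_add, exp_softValue_div hq' hτ,
      ← integral_mul_const]
    refine integral_mono (integrable_exp_div hq τ x _)
      ((integrable_exp_div hq' τ x _).mul_const _) fun a => ?_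
    simp only [← Real.exp_add, ← add_div]
    gcongr
    exact h (x, a)

variable (πref) in
theorem measurableSet_mem_optActions (hq : BddMeasurable q) :
    MeasurableSet {s : X × A | s.2 ∈ optActions πref q s.1} :=
  measurableSet_eq_fun hq.1
    (((isSupLipschitz_refValue πref).bddMeasurable hq).1.comp measurable_fst)

theorem measurableSet_optActions (hq : BddMeasurable q) (x : X) :
    MeasurableSet (optActions πref q x) :=
  measurable_prodMk_left (measurableSet_mem_optActions πref hq)

/-- Keep only the maximizers in the partition function. -/
theorem refValue_sub_le_softValue (hq : BddMeasurable q) (hτ : 0 < τ) {c : ℝ} (hc : 0 < c)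
    (hcov : IsCovered πref c q) (x : X) :
    refValue πref q x - τ * Real.log c⁻¹ ≤ softValue πref τ q x := by
  set m := refValue πref q x
  have hpartition : c * Real.exp (m / τ) ≤ Real.exp (softValue πref τ q x / τ) := by
    rw [exp_softValue_div hq hτ]
    calc c * Real.exp (m / τ)
        ≤ (πref x).real (optActions πref q x) * Real.exp (m / τ) := by
          gcongr
          exact (ENNReal.ofReal_le_iff_le_toReal (measure_ne_top _ _)).1 (hcov x)
      _ = ∫ _ in optActions πref q x, Real.exp (m / τ) ∂(πref x) := by simp
      _ = ∫ a in optActions πref q x, Real.exp (q (x, a) / τ) ∂(πref x) :=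
          setIntegral_congr_fun (measurableSet_optActions hq x) fun a (ha : q (x, a) = m) => by
            simp only [ha]
      _ ≤ _ := setIntegral_le_integral (integrable_exp_div hq τ x _)
          (ae_of_all _ fun a => (Real.exp_pos _).le)
  rw [← Real.exp_log hc, ← Real.exp_add, Real.exp_le_exp, ← sub_nonneg] at hpartition
  have := mul_nonneg hτ.le hpartition
  rw [mul_sub, mul_add, mul_div_cancel₀ _ hτ.ne', mul_div_cancel₀ _ hτ.ne'] at this
  rw [Real.log_inv]
  linarith

theorem abs_softValue_sub_refValue_le (hq : BddMeasurable q) (hτ : 0 < τ) {c : ℝ} (hc : 0 < c)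
    (hcov : IsCovered πref c q) (x : X) :
    |softValue πref τ q x - refValue πref q x| ≤ τ * Real.log c⁻¹ := by
  have hle := softValue_le_refValue (πref := πref) hq hτ x
  have hge := refValue_sub_le_softValue hq hτ hc hcov x
  exact abs_sub_le_iff.2 ⟨by linarith, by linarith⟩

end Values

section Optimality

variable (M : MDP X A) (πref : Kernel X A)

theorem bellmanBackup_le_add {v v' : X → ℝ} (hv : BddMeasurable v) (hv' : BddMeasurable v')
    {c : ℝ} (h : ∀ x, v x ≤ v' x + c) (s : X × A) :
    M.bellmanBackup v s ≤ M.bellmanBackup v' s + M.γ * c := by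
  have := M.markov_P
  have hmono := mul_le_mul_of_nonneg_left (hv.integral_le_add hv' h (M.P s)) M.γ_pos.le
  unfold bellmanBackup
  linarith

theorem isSupLipschitz_bellmanBackup : IsSupLipschitz M.γ M.bellmanBackup := by
  refine .of_le_add (fun {v} hv => ?_) ?_ (fun hv hv' _ => M.bellmanBackup_le_add hv hv')
  · have := M.markov_P
    exact M.bddMeasurable_r.1.add
      ((hv.1.stronglyMeasurable.integral_kernel (κ := M.P)).measurable.const_mul _)
  · simpa [bellmanBackup] using M.bddMeasurable_r.2

variable [IsMarkovKernel πref]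

theorem isSupLipschitz_softBellman {τ : ℝ} (hτ : 0 < τ) :
    IsSupLipschitz M.γ (M.softBellman πref τ) := by
  rw [← mul_one M.γ]
  exact M.isSupLipschitz_bellmanBackup.comp (isSupLipschitz_softValue πref hτ)

theorem isSupLipschitz_refBellman : IsSupLipschitz M.γ (M.refBellman πref) := by
  rw [← mul_one M.γ]
  exact M.isSupLipschitz_bellmanBackup.comp (isSupLipschitz_refValue πref)

theorem qSoft_spec {τ : ℝ} (hτ : 0 < τ) :
    BddMeasurable (M.qSoft πref τ) ∧ M.softBellman πref τ (M.qSoft πref τ) = M.qSoft πref τ :=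
  Classical.epsilon_spec
    ((M.isSupLipschitz_softBellman πref hτ).exists_fixedPoint M.γ_pos.le M.γ_lt_one)

theorem qRef_spec :
    BddMeasurable (M.qRef πref) ∧ M.refBellman πref (M.qRef πref) = M.qRef πref :=
  Classical.epsilon_spec
    ((M.isSupLipschitz_refBellman πref).exists_fixedPoint M.γ_pos.le M.γ_lt_one)

variable {M πref} {c : ℝ}

theorem abs_qSoft_sub_qRef_le (hc : 0 < c) {τ : ℝ} (hτ : 0 < τ)
    (hcov : IsCovered πref c (M.qSoft πref τ)) (s : X × A) :
    |M.qSoft πref τ s - M.qRef πref s| ≤ M.γ * (τ * Real.log c⁻¹) / (1 - M.γ) := by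
  obtain ⟨hsoft, hsoft_fix⟩ := M.qSoft_spec πref hτ
  obtain ⟨href, href_fix⟩ := M.qRef_spec πref
  refine le_div_of_self_improving M.γ_lt_one (hsoft.sub href).2 (fun e he s => ?_) s
  nth_rw 1 [← hsoft_fix, ← href_fix]
  rw [← mul_add]
  refine M.isSupLipschitz_bellmanBackup.abs_sub_le
    ((isSupLipschitz_softValue πref hτ).bddMeasurable hsoft)
    ((isSupLipschitz_refValue πref).bddMeasurable href) (fun x => ?_) s
  refine (abs_sub_le _ (refValue πref (M.qSoft πref τ) x) _).trans (add_le_add ?_ ?_)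
  · exact abs_softValue_sub_refValue_le hsoft hτ hc hcov x
  · simpa using (isSupLipschitz_refValue πref).abs_sub_le hsoft href he x

theorem exists_abs_qSoft_sub_qRef_le (hc : 0 < c)
    (hcov : ∀ τ : ℝ, 0 < τ → IsCovered πref c (M.qSoft πref τ)) {e : ℝ} (he : 0 < e) :
    ∃ τ : ℝ, 0 < τ ∧ ∀ s, |M.qSoft πref τ s - M.qRef πref s| ≤ e := by
  have hlim : Tendsto (fun τ : ℝ => M.γ * (τ * Real.log c⁻¹) / (1 - M.γ)) (𝓝[>] 0) (𝓝 0) :=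
    tendsto_nhdsWithin_of_tendsto_nhds (Continuous.tendsto' (by fun_prop) _ _ (by simp))
  obtain ⟨τ, hτe, hτ⟩ := ((hlim.eventually_le_const he).and self_mem_nhdsWithin).exists
  exact ⟨τ, hτ, fun s => (abs_qSoft_sub_qRef_le hc hτ (hcov τ hτ) s).trans hτe⟩

theorem isCovered_qRef (hc : 0 < c)
    (hcov : ∀ τ : ℝ, 0 < τ → IsCovered πref c (M.qSoft πref τ)) :
    IsCovered πref c (M.qRef πref) := by
  intro x
  obtain ⟨href, -⟩ := M.qRef_spec πref
  refine le_measure_eq_essSup (href.prodMk_left x).1 (href.prodMk_left x).2 fun e he => ?_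
  obtain ⟨τ, hτ, hnear⟩ := exists_abs_qSoft_sub_qRef_le hc hcov (half_pos he)
  refine (hcov τ hτ x).trans (measure_mono fun a (ha : _ = refValue πref (M.qSoft πref τ) x) => ?_)
  have hvalue := abs_sub_le_iff.1
    ((isSupLipschitz_refValue πref).abs_sub_le (M.qSoft_spec πref hτ).1 href hnear x)
  have haction := abs_sub_le_iff.1 (hnear (x, a))
  change refValue πref (M.qRef πref) x - e ≤ M.qRef πref (x, a)
  linarith

end Optimality

/-- The per-step regularization cost `x ↦ τ KL(π_x ‖ πref_x)`. -/
noncomputable def klCost (πref : Kernel X A) (τ : ℝ) (π : Kernel X A) (x : X) : ℝ :=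
  τ * (InformationTheory.klDiv (π x) (πref x)).toReal

theorem klCost_nonneg {τ : ℝ} (hτ : 0 < τ) (πref π : Kernel X A) (x : X) :
    0 ≤ klCost πref τ π x := by
  unfold klCost
  positivity

/-- The one-step loss `τ log c⁻¹ + 2η` incurred by a Boltzmann-Gibbs policy at temperature `τ` of
an `η`-approximation of a `c`-covered action-value function. -/
noncomputable def softSlack (c τ η : ℝ) : ℝ := τ * Real.log c⁻¹ + 2 * η

section Boltzmann

variable {πref : Kernel X A} [IsMarkovKernel πref] {q u : X × A → ℝ} {c τ η : ℝ}

theorem boltzmann_apply (hq : BddMeasurable q) (hτ : 0 < τ) (x : X) :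
    boltzmann πref τ q x = (πref x).withDensity fun a =>
      ENNReal.ofReal (Real.exp ((q (x, a) - softValue πref τ q x) / τ)) := by
  refine Kernel.withDensity_apply _ ?_ _
  have hqm := hq.1
  have hvm := ((isSupLipschitz_softValue πref hτ).bddMeasurable hq).1
  simp only [Function.uncurry_def, Prod.mk.eta]
  fun_prop

theorem boltzmann_apply_eq_tilted (hq : BddMeasurable q) (hτ : 0 < τ) (x : X) :
    boltzmann πref τ q x = (πref x).tilted fun a => q (x, a) / τ := by
  simp only [boltzmann_apply hq hτ, Measure.tilted, sub_div, Real.exp_sub, exp_softValue_div hq hτ]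

theorem isMarkovKernel_boltzmann (hq : BddMeasurable q) (hτ : 0 < τ) :
    IsMarkovKernel (boltzmann πref τ q) := by
  refine ⟨fun x => ?_⟩
  rw [boltzmann_apply_eq_tilted hq hτ]
  exact isProbabilityMeasure_tilted (integrable_exp_div hq τ x _)

theorem boltzmann_absolutelyContinuous (hq : BddMeasurable q) (hτ : 0 < τ) (x : X) :
    boltzmann πref τ q x ≪ πref x := by
  rw [boltzmann_apply_eq_tilted hq hτ]
  exact tilted_absolutelyContinuous _ _

theorem klCost_boltzmann (hq : BddMeasurable q) (hτ : 0 < τ) (x : X) :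
    klCost πref τ (boltzmann πref τ q) x
      = policyValue (boltzmann πref τ q) q x - softValue πref τ q x := by
  have := isMarkovKernel_boltzmann (πref := πref) hq hτ
  have hac := boltzmann_absolutelyContinuous (πref := πref) hq hτ x
  have hllr : llr (boltzmann πref τ q x) (πref x) =ᵐ[boltzmann πref τ q x]
      fun a => q (x, a) / τ - softValue πref τ q x / τ := by
    rw [← Real.log_exp (softValue πref τ q x / τ), exp_softValue_div hq hτ]
    refine hac.ae_le ?_
    rw [boltzmann_apply_eq_tilted hq hτ]
    exact log_rnDeriv_tilted_left_self (integrable_exp_div hq τ x _)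
  have hint := (hq.prodMk_left x).integrable (boltzmann πref τ q x)
  rw [klCost, InformationTheory.toReal_klDiv_of_measure_eq hac (by simp), integral_congr_ae hllr,
    integral_sub (hint.div_const τ) (integrable_const _), integral_div, mul_sub,
    mul_div_cancel₀ _ hτ.ne', integral_const, probReal_univ, one_smul, mul_div_cancel₀ _ hτ.ne']
  rfl

theorem bddMeasurable_klCost_boltzmann (hq : BddMeasurable q) (hτ : 0 < τ) :
    BddMeasurable (klCost πref τ (boltzmann πref τ q)) := by
  have := isMarkovKernel_boltzmann (πref := πref) hq hτ
  rw [funext (klCost_boltzmann hq hτ)]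
  exact ((isSupLipschitz_policyValue _).bddMeasurable hq).sub
    ((isSupLipschitz_softValue πref hτ).bddMeasurable hq)

theorem refValue_add_klCost_le (hq : BddMeasurable q) (hu : BddMeasurable u)
    (hqu : ∀ s, |q s - u s| ≤ η) (hτ : 0 < τ) (hc : 0 < c) (hcov : IsCovered πref c u) (x : X) :
    refValue πref u x + klCost πref τ (boltzmann πref τ q) x
      ≤ policyValue (boltzmann πref τ q) u x + softSlack c τ η := by
  have := isMarkovKernel_boltzmann (πref := πref) hq hτ
  have hpolicy := abs_sub_le_iff.1
    ((isSupLipschitz_policyValue (boltzmann πref τ q)).abs_sub_le hq hu hqu x)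
  have hsoft := abs_sub_le_iff.1 ((isSupLipschitz_softValue πref hτ).abs_sub_le hq hu hqu x)
  have hcovered := refValue_sub_le_softValue hu hτ hc hcov x
  rw [klCost_boltzmann hq hτ, softSlack]
  linarith

theorem policyValue_boltzmann_le_refValue (hq : BddMeasurable q) (hu : BddMeasurable u)
    (hτ : 0 < τ) (x : X) : policyValue (boltzmann πref τ q) u x ≤ refValue πref u x :=
  have := isMarkovKernel_boltzmann (πref := πref) hq hτ
  policyValue_le_refValue hu (boltzmann_absolutelyContinuous hq hτ x)

theorem klCost_boltzmann_le_softSlack (hq : BddMeasurable q) (hu : BddMeasurable u)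
    (hqu : ∀ s, |q s - u s| ≤ η) (hτ : 0 < τ) (hc : 0 < c) (hcov : IsCovered πref c u) (x : X) :
    klCost πref τ (boltzmann πref τ q) x ≤ softSlack c τ η := by
  have hle := policyValue_boltzmann_le_refValue (πref := πref) hq hu hτ x
  linarith [refValue_add_klCost_le hq hu hqu hτ hc hcov x]

theorem klCost_boltzmann_le_two_mul (hq : BddMeasurable q) (hτ : 0 < τ) {Q : ℝ}
    (hQ : ∀ s, |q s| ≤ Q) (x : X) : klCost πref τ (boltzmann πref τ q) x ≤ 2 * Q := by
  have hcov : IsCovered πref 1 (fun _ => 0) := fun x => by simp [optActions]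
  have hle := klCost_boltzmann_le_softSlack hq (BddMeasurable.const 0) (by simpa using hQ) hτ
    one_pos hcov x
  simpa [softSlack] using hle

theorem refValue_le_policyValue_boltzmann_add (hq : BddMeasurable q) (hu : BddMeasurable u)
    (hqu : ∀ s, |q s - u s| ≤ η) (hτ : 0 < τ) (hc : 0 < c) (hcov : IsCovered πref c u) (x : X) :
    refValue πref u x ≤ policyValue (boltzmann πref τ q) u x + softSlack c τ η := by
  have hkl := klCost_nonneg hτ πref (boltzmann πref τ q) x
  linarith [refValue_add_klCost_le hq hu hqu hτ hc hcov x]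

theorem abs_policyValue_sub_klCost_sub_refValue_le (hq : BddMeasurable q) (hu : BddMeasurable u)
    (hqu : ∀ s, |q s - u s| ≤ η) (hτ : 0 < τ) (hc : 0 < c) (hcov : IsCovered πref c u) (x : X) :
    |policyValue (boltzmann πref τ q) u x - klCost πref τ (boltzmann πref τ q) x
      - refValue πref u x| ≤ softSlack c τ η := by
  have hge := refValue_add_klCost_le hq hu hqu hτ hc hcov x
  have hle := policyValue_boltzmann_le_refValue (πref := πref) hq hu hτ x
  have hkl := klCost_nonneg hτ πref (boltzmann πref τ q) x
  exact abs_sub_le_iff.2 ⟨by linarith, by linarith⟩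

end Boltzmann

end MDP

section RandomUpdate

variable {S E E' : Type*} [MeasurableSpace S] [MeasurableSpace E] [MeasurableSpace E']

/-- The kernel sending `s` to the law of `G (s, (s', z))`, where `s' ∼ k_s` and `z ∼ ζ_{s'}`. The
distributional Bellman operators, and their joint action on pairs of returns, have this form. -/
noncomputable def randomUpdate (k : Kernel S S) (G : S × (S × E) → E) (ζ : Kernel S E) :
    Kernel S E :=
  (Kernel.id.compProd (Kernel.prodMkLeft S (k.compProd (Kernel.prodMkLeft S ζ)))).map G

instance (k : Kernel S S) (G : S × (S × E) → E) (ζ : Kernel S E) :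
    IsSFiniteKernel (randomUpdate k G ζ) := by
  unfold randomUpdate
  infer_instance

variable {k k' : Kernel S S} {G : S × (S × E) → E} {G' : S × (S × E') → E'} {ζ : Kernel S E}
  {ζ' : Kernel S E'}

theorem randomUpdate_apply (hG : Measurable G) (s : S) :
    randomUpdate k G ζ s
      = (k.compProd (Kernel.prodMkLeft S ζ) s).map fun w => G (s, w) := by
  rw [randomUpdate, Kernel.map_apply _ hG]
  ext t ht
  rw [Measure.map_apply hG ht, Measure.map_apply (by fun_prop) ht, Kernel.compProd_apply (hG ht),
    Kernel.lintegral_id']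
  · rfl
  · exact Kernel.measurable_kernel_prodMk_left (κ := k.compProd (Kernel.prodMkLeft S ζ)) (hG ht)

variable [IsSFiniteKernel k] [IsSFiniteKernel k'] [IsSFiniteKernel ζ] [IsSFiniteKernel ζ']

theorem lintegral_randomUpdate (hG : Measurable G) {f : E → ℝ≥0∞} (hf : Measurable f) (s : S) :
    ∫⁻ z, f z ∂(randomUpdate k G ζ s) = ∫⁻ s', ∫⁻ z, f (G (s, (s', z))) ∂(ζ s') ∂(k s) := by
  rw [randomUpdate_apply hG, lintegral_map hf (by fun_prop),
    Kernel.lintegral_compProd _ _ _ (by fun_prop)]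
  rfl

theorem randomUpdate_apply_univ (hG : Measurable G) (s : S) :
    randomUpdate k G ζ s Set.univ = ∫⁻ s', ζ s' Set.univ ∂(k s) := by
  simpa using lintegral_randomUpdate (k := k) (ζ := ζ) hG measurable_one s

theorem isMarkovKernel_randomUpdate [IsMarkovKernel k] [IsMarkovKernel ζ] (hG : Measurable G) :
    IsMarkovKernel (randomUpdate k G ζ) :=
  ⟨fun s => ⟨by simp [randomUpdate_apply_univ hG]⟩⟩

theorem map_randomUpdate_le (hk : ∀ s, k s ≤ k' s) {φ : E → E'} (hφ : Measurable φ)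
    (hζ : ∀ s, (ζ s).map φ ≤ ζ' s) (hG : Measurable G) (hG' : Measurable G')
    (hGG' : ∀ s s' z, φ (G (s, (s', z))) = G' (s, (s', φ z))) (s : S) :
    (randomUpdate k G ζ s).map φ ≤ randomUpdate k' G' ζ' s := by
  refine Measure.le_iff.2 fun t ht => ?_
  have hind : Measurable (t.indicator (1 : E' → ℝ≥0∞)) := measurable_one.indicator ht
  rw [← lintegral_indicator_one ht, ← lintegral_indicator_one ht, lintegral_map hind hφ,
    lintegral_randomUpdate (f := fun z => t.indicator 1 (φ z)) hG (hind.comp hφ),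
    lintegral_randomUpdate hG' hind]
  refine lintegral_mono' (hk s) fun s' => ?_
  simp only [hGG']
  rw [← lintegral_map (f := fun z => t.indicator 1 (G' (s, (s', z)))) (by fun_prop) hφ]
  exact lintegral_mono' (hζ s') le_rfl

instance (n : ℕ) : IsSFiniteKernel ((randomUpdate k G)^[n] ζ) := by
  cases n with
  | zero => assumption
  | succ n =>
    rw [Function.iterate_succ_apply']
    infer_instance

theorem map_iterate_randomUpdate_le (hk : ∀ s, k s ≤ k' s) {φ : E → E'} (hφ : Measurable φ)
    (hζ : ∀ s, (ζ s).map φ ≤ ζ' s) (hG : Measurable G) (hG' : Measurable G')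
    (hGG' : ∀ s s' z, φ (G (s, (s', z))) = G' (s, (s', φ z))) (n : ℕ) (s : S) :
    ((randomUpdate k G)^[n] ζ s).map φ ≤ (randomUpdate k' G')^[n] ζ' s := by
  induction n generalizing s with
  | zero => exact hζ s
  | succ n ih =>
    rw [Function.iterate_succ_apply', Function.iterate_succ_apply']
    exact map_randomUpdate_le hk hφ ih hG hG' hGG' s

theorem eLpNorm_le_iff_lintegral_le {Ω F : Type*} [MeasurableSpace Ω] [NormedAddCommGroup F]
    {μ : Measure Ω} {f : Ω → F} {p : ℝ} (hp : 0 < p) {C : ℝ≥0∞} :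
    eLpNorm f (ENNReal.ofReal p) μ ≤ C ↔ ∫⁻ ω, ‖f ω‖ₑ ^ p ∂μ ≤ C ^ p := by
  rw [eLpNorm_eq_lintegral_rpow_enorm_toReal (by simpa using hp) ENNReal.ofReal_ne_top,
    ENNReal.toReal_ofReal hp.le, one_div, ENNReal.rpow_inv_le_iff hp]

theorem eLpNorm_randomUpdate_le (hk : ∀ s, k s Set.univ ≤ 1) (hG : Measurable G) {f : E → ℝ}
    (hf : Measurable f) {p γ : ℝ} (hp : 0 < p)
    (hfG : ∀ s s' z, ‖f (G (s, (s', z)))‖ ≤ γ * ‖f z‖) {C : ℝ≥0∞}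
    (hC : ∀ s, eLpNorm f (ENNReal.ofReal p) (ζ s) ≤ C) (s : S) :
    eLpNorm f (ENNReal.ofReal p) (randomUpdate k G ζ s) ≤ ENNReal.ofReal γ * C := by
  rw [eLpNorm_le_iff_lintegral_le hp, lintegral_randomUpdate hG (by fun_prop)]
  have hpt (s' : S) (z : E) :
      ‖f (G (s, (s', z)))‖ₑ ^ p ≤ ENNReal.ofReal γ ^ p * ‖f z‖ₑ ^ p := by
    rw [← ENNReal.mul_rpow_of_nonneg _ _ hp.le]
    refine ENNReal.rpow_le_rpow ?_ hp.le
    rw [← ofReal_norm, ← ofReal_norm, ← ENNReal.ofReal_mul' (norm_nonneg _)]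
    exact ENNReal.ofReal_le_ofReal (hfG s s' z)
  calc ∫⁻ s', ∫⁻ z, ‖f (G (s, (s', z)))‖ₑ ^ p ∂(ζ s') ∂(k s)
      ≤ ∫⁻ _, ENNReal.ofReal γ ^ p * C ^ p ∂(k s) := lintegral_mono fun s' => by
        refine (lintegral_mono (hpt s')).trans ?_
        rw [lintegral_const_mul _ (by fun_prop)]
        gcongr
        exact (eLpNorm_le_iff_lintegral_le hp).1 (hC s')
    _ ≤ (ENNReal.ofReal γ * C) ^ p := by
        rw [lintegral_const, ENNReal.mul_rpow_of_nonneg _ _ hp.le]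
        exact mul_le_of_le_one_right zero_le (hk s)

theorem eLpNorm_iterate_randomUpdate_le (hk : ∀ s, k s Set.univ ≤ 1) (hG : Measurable G)
    {f : E → ℝ} (hf : Measurable f) {p γ : ℝ} (hp : 0 < p)
    (hfG : ∀ s s' z, ‖f (G (s, (s', z)))‖ ≤ γ * ‖f z‖) {C : ℝ≥0∞}
    (hC : ∀ s, eLpNorm f (ENNReal.ofReal p) (ζ s) ≤ C) (n : ℕ) (s : S) :
    eLpNorm f (ENNReal.ofReal p) ((randomUpdate k G)^[n] ζ s) ≤ ENNReal.ofReal γ ^ n * C := by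
  induction n generalizing s with
  | zero => simpa using hC s
  | succ n ih =>
    rw [Function.iterate_succ_apply', pow_succ', mul_assoc]
    exact eLpNorm_randomUpdate_le hk hG hf hp hfG ih s

end RandomUpdate

section Mean

variable {S : Type*} [MeasurableSpace S] {ζ : Kernel S ℝ} {p : ℝ}

theorem hasBoundedMoment_iff (hp : 0 < p) :
    HasBoundedMoment p ζ ↔ IsMarkovKernel ζ ∧
      ∃ m : ℝ≥0∞, m ≠ ⊤ ∧ ∀ s, eLpNorm (fun z => z) (ENNReal.ofReal p) (ζ s) ≤ m := by
  have hmoment (s : S) : ∫⁻ z, ENNReal.ofReal (|z| ^ p) ∂(ζ s) = ∫⁻ z, ‖z‖ₑ ^ p ∂(ζ s) :=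
    lintegral_congr fun z => by
      rw [Real.enorm_eq_ofReal_abs, ENNReal.ofReal_rpow_of_nonneg (abs_nonneg z) hp.le]
  simp only [HasBoundedMoment, hmoment, eLpNorm_le_iff_lintegral_le hp]
  refine and_congr_right fun _ => ⟨fun h => ?_, fun ⟨m, hm, h⟩ => ?_⟩
  · refine ⟨_, (ENNReal.rpow_lt_top_of_nonneg (inv_nonneg.2 hp.le) h.ne).ne, fun s => ?_⟩
    rw [ENNReal.rpow_inv_rpow hp.ne']
    exact le_iSup (fun s => ∫⁻ z, ‖z‖ₑ ^ p ∂(ζ s)) s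
  · exact (iSup_le h).trans_lt (ENNReal.rpow_lt_top_of_nonneg hp.le hm)

namespace HasBoundedMoment

theorem exists_lintegral_enorm_le (hζ : HasBoundedMoment p ζ) (hp : 1 ≤ p) :
    ∃ m : ℝ≥0∞, m ≠ ⊤ ∧ ∀ s, ∫⁻ z, ‖z‖ₑ ∂(ζ s) ≤ m := by
  obtain ⟨hM, m, hm, h⟩ := (hasBoundedMoment_iff (by linarith)).1 hζ
  refine ⟨m, hm, fun s => ?_⟩
  rw [← eLpNorm_one_eq_lintegral_enorm]
  exact (eLpNorm_le_eLpNorm_of_exponent_le (by simpa using hp) (by fun_prop)).trans (h s)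

theorem bddMeasurable_meanFn (hζ : HasBoundedMoment p ζ) (hp : 1 ≤ p) :
    BddMeasurable (meanFn ζ) := by
  obtain ⟨m, hm, h⟩ := hζ.exists_lintegral_enorm_le hp
  have := hζ.1
  refine ⟨(stronglyMeasurable_id.integral_kernel (κ := ζ)).measurable, m.toReal, fun s => ?_⟩
  rw [← Real.norm_eq_abs, ← toReal_enorm]
  exact ENNReal.toReal_mono hm ((enorm_integral_le_lintegral_enorm _).trans (h s))

theorem meanFn_randomUpdate_affine (hζ : HasBoundedMoment p ζ) (hp : 1 ≤ p) (k : Kernel S S)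
    [IsMarkovKernel k] {b : S × S → ℝ} (hb : BddMeasurable b) (γ : ℝ) (s : S) :
    meanFn (randomUpdate k (fun w => b (w.1, w.2.1) + γ * w.2.2) ζ) s
      = ∫ s', (b (s, s') + γ * meanFn ζ s') ∂(k s) := by
  obtain ⟨m, hm, h⟩ := hζ.exists_lintegral_enorm_le hp
  have := hζ.1
  have hbm := hb.1
  have hsnd : Integrable (fun w : S × ℝ => w.2) (k.compProd (Kernel.prodMkLeft S ζ) s) := by
    refine ⟨by fun_prop, ?_⟩
    rw [HasFiniteIntegral, Kernel.lintegral_compProd _ _ _ (by fun_prop)]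
    exact (lintegral_mono h).trans_lt (by simpa using hm.lt_top)
  have hfst : Integrable (fun w : S × ℝ => b (s, w.1)) (k.compProd (Kernel.prodMkLeft S ζ) s) :=
    BddMeasurable.integrable ⟨by fun_prop, hb.2.imp fun _ hC w => hC (s, w.1)⟩ _
  have hmean (s' : S) : ∫ z, (b (s, s') + γ * z) ∂(ζ s') = b (s, s') + γ * meanFn ζ s' := by
    have hint : Integrable (fun z => z) (ζ s') :=
      ⟨by fun_prop, (h s').trans_lt hm.lt_top⟩
    rw [integral_add (integrable_const _) (hint.const_mul γ), integral_const_mul]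
    simp [meanFn]
  have hsum : Integrable (fun w : S × ℝ => b (s, w.1) + γ * w.2)
      (k.compProd (Kernel.prodMkLeft S ζ) s) := hfst.add (hsnd.const_mul γ)
  rw [meanFn, randomUpdate_apply (by fun_prop), integral_map (by fun_prop) (by fun_prop)]
  exact (ProbabilityTheory.integral_compProd hsum).trans (integral_congr_ae (ae_of_all _ hmean))

end HasBoundedMoment

end Mean

section MarkovChain

variable {S : Type*}

/-- Extension of a history by one final entry. -/
def snocHistory (n : ℕ) (h : (_ : Finset.Iic n) → S) (z : S) (i : Finset.Iic (n + 1)) : S :=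
  if hi : i.1 ≤ n then h ⟨i.1, Finset.mem_Iic.2 hi⟩ else z

/-- Extension of a history by one initial entry. -/
def consHistory (n : ℕ) (s : S) (h : (_ : Finset.Iic n) → S) : (_ : Finset.Iic (n + 1)) → S
  | ⟨0, _⟩ => s
  | ⟨i + 1, hi⟩ => h ⟨i, by simpa using hi⟩

/-- Extension of a sequence by one initial entry. -/
def consSeq (s : S) (ω : ℕ → S) : ℕ → S
  | 0 => s
  | i + 1 => ω i

theorem consHistory_snocHistory (n : ℕ) (s : S) (h : (_ : Finset.Iic n) → S) (z : S) :
    consHistory (n + 1) s (snocHistory n h z) = snocHistory (n + 1) (consHistory n s h) z := by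
  funext ⟨i, hi⟩
  cases i <;> simp [consHistory, snocHistory]

variable [MeasurableSpace S]

/-- The transitions of the homogeneous Markov chain with transition kernel `k`, as kernels on
histories. -/
noncomputable def historyStep (k : Kernel S S) (n : ℕ) : Kernel ((_ : Finset.Iic n) → S) S :=
  k.comap (fun h => h ⟨n, Finset.mem_Iic.2 le_rfl⟩) (measurable_pi_apply _)

instance (k : Kernel S S) [IsMarkovKernel k] (n : ℕ) : IsMarkovKernel (historyStep k n) := by
  unfold historyStep
  infer_instance

/-- The law of the homogeneous Markov chain with transition kernel `k`, as a function of its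
starting point. -/
noncomputable def markovChain (k : Kernel S S) [IsMarkovKernel k] : Kernel S (ℕ → S) :=
  (Kernel.traj (X := fun _ => S) (historyStep k) 0).comap
    (fun s _ => s) (measurable_pi_lambda _ fun _ => measurable_id)

instance (k : Kernel S S) [IsMarkovKernel k] : IsMarkovKernel (markovChain k) := by
  unfold markovChain
  infer_instance

theorem measurable_snocHistory (n : ℕ) (h : (_ : Finset.Iic n) → S) :
    Measurable (snocHistory n h) := by
  refine measurable_pi_lambda _ fun i => ?_
  unfold snocHistory
  split_ifs <;> fun_prop

theorem measurable_consHistory (n : ℕ) (s : S) : Measurable (consHistory n s) := by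
  refine measurable_pi_lambda _ ?_
  rintro ⟨_ | i, hi⟩
  · exact measurable_const
  · exact measurable_pi_apply _

theorem measurable_consSeq (s : S) : Measurable (consSeq s) := by
  refine measurable_pi_lambda _ ?_
  rintro (_ | i)
  · exact measurable_const
  · exact measurable_pi_apply _

theorem measure_ext_of_map_frestrictLe {μ ν : Measure (ℕ → S)} [IsFiniteMeasure ν]
    (h : ∀ n, μ.map (Preorder.frestrictLe (π := fun _ => S) n)
      = ν.map (Preorder.frestrictLe (π := fun _ => S) n)) : μ = ν := by
  have hν : IsProjectiveMeasureFamily (α := fun _ : ℕ => S) fun I => ν.map I.restrict := by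
    intro I J hJI
    rw [Measure.map_map (Finset.measurable_restrict₂ hJI) (Finset.measurable_restrict I)]
    rfl
  have hμ : IsProjectiveLimit (α := fun _ : ℕ => S) μ fun I => ν.map I.restrict :=
    (isProjectiveLimit_nat_iff hν μ).2 h
  have (I : Finset ℕ) : IsFiniteMeasure (ν.map (I.restrict (π := fun _ => S))) := inferInstance
  exact hμ.unique fun _ => rfl

variable (k : Kernel S S)

/-- The law of the first `n + 1` entries of the Markov chain with transition kernel `k`. -/
noncomputable def chainHistory (n : ℕ) : Kernel S ((_ : Finset.Iic n) → S) :=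
  (Kernel.partialTraj (X := fun _ => S) (historyStep k) 0 n).comap
    (fun s _ => s) (measurable_pi_lambda _ fun _ => measurable_id)

theorem chainHistory_zero_apply (s : S) : chainHistory k 0 s = Measure.dirac fun _ => s := by
  rw [chainHistory, Kernel.comap_apply, Kernel.partialTraj_self, Kernel.id_apply]

theorem chainHistory_succ (n : ℕ) :
    chainHistory k (n + 1)
      = Kernel.partialTraj (X := fun _ => S) (historyStep k) n (n + 1) ∘ₖ chainHistory k n := by
  ext1 s
  rw [chainHistory, Kernel.partialTraj_succ_eq_comp n.zero_le]
  rfl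

variable [IsMarkovKernel k]

theorem partialTraj_succ_self_apply (n : ℕ) (y : (_ : Finset.Iic n) → S) :
    Kernel.partialTraj (X := fun _ => S) (historyStep k) n (n + 1) y
      = (k (y ⟨n, Finset.mem_Iic.2 le_rfl⟩)).map (snocHistory n y) := by
  have hm : Measurable (IicProdIoc (X := fun _ => S) n (n + 1)) := measurable_IicProdIoc
  have hp : Measurable (MeasurableEquiv.piSingleton (X := fun _ => S) n) :=
    (MeasurableEquiv.piSingleton (X := fun _ => S) n).measurable
  rw [Kernel.partialTraj_succ_self, Kernel.map_apply _ hm, Kernel.prod_apply,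
    Kernel.id_apply, Measure.dirac_prod, Kernel.map_apply _ hp,
    Measure.map_map measurable_prodMk_left hp,
    Measure.map_map hm (measurable_prodMk_left.comp hp)]
  congr 1
  funext z i
  simp only [Function.comp_apply, IicProdIoc, snocHistory]
  split_ifs
  · rfl
  · simp [MeasurableEquiv.piSingleton]

theorem partialTraj_map_consHistory (n : ℕ) (s : S) :
    (Kernel.partialTraj (X := fun _ => S) (historyStep k) n (n + 1)).map (consHistory (n + 1) s)
      = (Kernel.partialTraj (X := fun _ => S) (historyStep k) (n + 1) (n + 2)).comap
          (consHistory n s) (measurable_consHistory n s) := by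
  ext1 y
  rw [Kernel.map_apply _ (measurable_consHistory _ _), Kernel.comap_apply,
    partialTraj_succ_self_apply, partialTraj_succ_self_apply,
    Measure.map_map (measurable_consHistory _ _) (measurable_snocHistory _ _)]
  congr 1
  exact funext (consHistory_snocHistory n s y)

theorem chainHistory_succ_apply_eq_map_consHistory (n : ℕ) (s : S) :
    chainHistory k (n + 1) s = (chainHistory k n ∘ₖ k).map (consHistory n s) s := by
  induction n with
  | zero =>
    have hconst : Measurable fun (z : S) (_ : Finset.Iic 0) => z := by fun_prop
    have hzero : chainHistory k 0 = Kernel.deterministic (fun z _ => z) hconst := by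
      ext1 z
      rw [chainHistory_zero_apply, Kernel.deterministic_apply]
    rw [chainHistory_succ, Kernel.comp_apply, chainHistory_zero_apply,
      Measure.dirac_bind (Kernel.measurable _), partialTraj_succ_self_apply, hzero,
      Kernel.deterministic_comp_eq_map, Kernel.map_apply _ (measurable_consHistory _ _),
      Kernel.map_apply _ hconst, Measure.map_map (measurable_consHistory _ _) hconst]
    congr 1
    funext z ⟨i, hi⟩
    cases i <;> simp [consHistory, snocHistory]
  | succ n ih =>
    rw [chainHistory_succ, Kernel.comp_apply, ih, ← Kernel.comp_apply,
      Kernel.comp_map _ _ (measurable_consHistory n s), ← partialTraj_map_consHistory,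
      ← Kernel.map_comp, ← Kernel.comp_assoc, ← chainHistory_succ]

theorem markovChain_map_frestrictLe (n : ℕ) :
    (markovChain k).map (Preorder.frestrictLe (π := fun _ => S) n) = chainHistory k n := by
  ext1 s
  rw [Kernel.map_apply _ (Preorder.measurable_frestrictLe n)]
  exact Kernel.traj_map_frestrictLe_apply ..

theorem markovChain_apply_eq_map_consSeq (s : S) :
    markovChain k s = (markovChain k ∘ₖ k).map (consSeq s) s := by
  have hcons := measurable_consSeq s
  have hrestrict (n : ℕ) : Measurable (Preorder.frestrictLe (π := fun _ : ℕ => S) n) :=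
    Preorder.measurable_frestrictLe n
  have := Kernel.IsMarkovKernel.map (markovChain k ∘ₖ k) hcons
  refine measure_ext_of_map_frestrictLe fun n => ?_
  rw [← Kernel.map_apply _ (hrestrict n), ← Kernel.map_apply _ (hrestrict n),
    markovChain_map_frestrictLe, ← Kernel.map_comp_right _ hcons (hrestrict n)]
  cases n with
  | zero =>
    have hfirst : Preorder.frestrictLe (π := fun _ : ℕ => S) 0 ∘ consSeq s = fun _ _ => s := by
      funext ω ⟨i, hi⟩
      obtain rfl : i = 0 := by simpa using hi
      rfl
    rw [hfirst, chainHistory_zero_apply, Kernel.map_apply _ measurable_const, Measure.map_const]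
    simp
  | succ n =>
    have hrestrict_cons : Preorder.frestrictLe (π := fun _ : ℕ => S) (n + 1) ∘ consSeq s
        = consHistory n s ∘ Preorder.frestrictLe (π := fun _ : ℕ => S) n := by
      funext ω ⟨i, hi⟩
      cases i <;> rfl
    rw [hrestrict_cons, Kernel.map_comp_right _ (hrestrict n) (measurable_consHistory n s),
      Kernel.map_comp, markovChain_map_frestrictLe, chainHistory_succ_apply_eq_map_consHistory]

end MarkovChain

section Excess

/-- The amount by which `|z|` exceeds the level `B`. The distributional Bellman operators contract
it, so that returns concentrate on `[-B, B]` for a suitable `B`. -/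
noncomputable def excess (B z : ℝ) : ℝ := max (|z| - B) 0

variable {B γ b z : ℝ}

@[fun_prop]
theorem measurable_excess (B : ℝ) : Measurable (excess B) := by
  unfold excess
  fun_prop

theorem excess_nonneg (B z : ℝ) : 0 ≤ excess B z := le_max_right _ _

theorem excess_eq_zero (hz : |z| ≤ B) : excess B z = 0 := max_eq_right (by linarith)

theorem excess_le_abs (hB : 0 ≤ B) (z : ℝ) : excess B z ≤ |z| :=
  max_le (by linarith) (abs_nonneg z)

theorem abs_le_add_excess (B z : ℝ) : |z| ≤ B + excess B z := by
  linarith [le_max_left (|z| - B) 0, excess.eq_def B z]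

theorem excess_affine_le (hγ : 0 ≤ γ) (hb : |b| ≤ (1 - γ) * B) (z : ℝ) :
    excess B (b + γ * z) ≤ γ * excess B z := by
  have htri := abs_add_le b (γ * z)
  rw [abs_mul, abs_of_nonneg hγ] at htri
  have hz := mul_le_mul_of_nonneg_left (abs_le_add_excess B z) hγ
  exact max_le (by linarith) (mul_nonneg hγ (excess_nonneg B z))

variable {Ω : Type*} [MeasurableSpace Ω] {μ : Measure Ω} {f : Ω → ℝ} {p : ℝ}

theorem eLpNorm_excess_le (hB : 0 ≤ B) :
    eLpNorm (fun ω => excess B (f ω)) (ENNReal.ofReal p) μ ≤ eLpNorm f (ENNReal.ofReal p) μ :=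
  eLpNorm_mono fun ω => by
    rw [Real.norm_of_nonneg (excess_nonneg _ _)]
    exact excess_le_abs hB _

theorem eLpNorm_le_add_eLpNorm_excess (hp : 1 ≤ p) (hB : 0 ≤ B) (hf : Measurable f) :
    eLpNorm f (ENNReal.ofReal p) μ ≤ ENNReal.ofReal B * μ Set.univ ^ (1 / p)
      + eLpNorm (fun ω => excess B (f ω)) (ENNReal.ofReal p) μ := by
  have hp' : (1 : ℝ≥0∞) ≤ ENNReal.ofReal p := by simpa using hp
  calc eLpNorm f (ENNReal.ofReal p) μ
      ≤ eLpNorm ((fun _ => B) + fun ω => excess B (f ω)) (ENNReal.ofReal p) μ :=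
        eLpNorm_mono_real fun ω => abs_le_add_excess B (f ω)
    _ ≤ eLpNorm (fun _ => B) (ENNReal.ofReal p) μ
          + eLpNorm (fun ω => excess B (f ω)) (ENNReal.ofReal p) μ :=
        eLpNorm_add_le (by fun_prop) ((measurable_excess B).comp hf).aestronglyMeasurable hp'
    _ = _ := by
        rw [eLpNorm_const' _ (by positivity) ENNReal.ofReal_ne_top,
          ENNReal.toReal_ofReal (by linarith), Real.enorm_of_nonneg hB]

/-- Probability kernels into `ℝ` whose excess over the level `B` has `L^p` norm at most `m`,
uniformly. -/
structure HasExcessBound {S : Type*} [MeasurableSpace S] (p B : ℝ) (m : ℝ≥0∞)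
    (ζ : Kernel S ℝ) : Prop where
  isMarkovKernel : IsMarkovKernel ζ
  eLpNorm_le : ∀ s, eLpNorm (excess B) (ENNReal.ofReal p) (ζ s) ≤ m

variable {S : Type*} [MeasurableSpace S] {ζ : Kernel S ℝ} {m : ℝ≥0∞}

theorem HasExcessBound.mono {m' : ℝ≥0∞} (hζ : HasExcessBound p B m ζ) (hmm' : m ≤ m') :
    HasExcessBound p B m' ζ :=
  ⟨hζ.isMarkovKernel, fun s => (hζ.eLpNorm_le s).trans hmm'⟩

theorem HasExcessBound.eLpNorm_id_le (hζ : HasExcessBound p B m ζ) (hp : 1 ≤ p) (hB : 0 ≤ B)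
    (s : S) : eLpNorm id (ENNReal.ofReal p) (ζ s) ≤ ENNReal.ofReal B + m := by
  have := hζ.isMarkovKernel
  refine (eLpNorm_le_add_eLpNorm_excess hp hB measurable_id).trans ?_
  rw [measure_univ, ENNReal.one_rpow, mul_one]
  exact add_le_add_right (hζ.eLpNorm_le s) _

theorem HasExcessBound.hasBoundedMoment (hζ : HasExcessBound p B m ζ) (hp : 1 ≤ p) (hB : 0 ≤ B)
    (hm : m ≠ ⊤) : HasBoundedMoment p ζ :=
  (hasBoundedMoment_iff (by linarith)).2
    ⟨hζ.isMarkovKernel, _, ENNReal.add_ne_top.2 ⟨ENNReal.ofReal_ne_top, hm⟩,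
      hζ.eLpNorm_id_le hp hB⟩

theorem HasBoundedMoment.exists_hasExcessBound (hζ : HasBoundedMoment p ζ) (hp : 0 < p) :
    ∃ m : ℝ≥0∞, m ≠ ⊤ ∧ ∀ B, 0 ≤ B → HasExcessBound p B m ζ := by
  obtain ⟨hM, m, hm, h⟩ := (hasBoundedMoment_iff hp).1 hζ
  exact ⟨m, hm, fun B hB => ⟨hM, fun s => (eLpNorm_excess_le hB).trans (h s)⟩⟩

end Excess

namespace MDP

variable {X A : Type*} [MeasurableSpace X] [MeasurableSpace A] (M : MDP X A)

section BellmanUpdate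

variable {R B p : ℝ} {m : ℝ≥0∞} {ζ : Kernel (X × A) ℝ} {ℓ : X → ℝ}

/-- The update `(s, (x', a', z)) ↦ r(s) - γ ℓ(x') + γ z` of a return when `ℓ` is charged at each
new state. The cost `ℓ = 0` gives the unregularized Bellman update. -/
noncomputable def costUpdate (ℓ : X → ℝ) (w : (X × A) × ((X × A) × ℝ)) : ℝ :=
  M.r w.1 - M.γ * ℓ w.2.1.1 + M.γ * w.2.2

theorem measurable_costUpdate (hℓ : Measurable ℓ) : Measurable (M.costUpdate ℓ) := by
  have hr := M.bddMeasurable_r.1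
  unfold costUpdate
  fun_prop

theorem excess_costUpdate_le (hR : ∀ s, |M.r s| ≤ R) {K : ℝ} (hK : ∀ x, |ℓ x| ≤ K)
    (hB : R + M.γ * K ≤ (1 - M.γ) * B) (s s' : X × A) (z : ℝ) :
    excess B (M.costUpdate ℓ (s, (s', z))) ≤ M.γ * excess B z := by
  refine excess_affine_le M.γ_pos.le ((abs_sub _ _).trans ?_) z
  rw [abs_mul, abs_of_pos M.γ_pos]
  linarith [hR s, mul_le_mul_of_nonneg_left (hK s'.1) M.γ_pos.le]

variable (π : Kernel X A) [IsMarkovKernel π]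

theorem integral_stepKernel {f : X × A → ℝ} (hf : BddMeasurable f) (s : X × A) :
    ∫ s', f s' ∂(M.stepKernel π s) = ∫ x, policyValue π f x ∂(M.P s) := by
  have := M.isMarkovKernel_stepKernel π
  have := M.markov_P
  exact ProbabilityTheory.integral_compProd (hf.integrable (M.stepKernel π s))

theorem hasExcessBound_randomUpdate_costUpdate (hp : 0 < p) (hζ : HasExcessBound p B m ζ)
    (hℓ : Measurable ℓ) (hR : ∀ s, |M.r s| ≤ R) {K : ℝ} (hK : ∀ x, |ℓ x| ≤ K)
    (hB : R + M.γ * K ≤ (1 - M.γ) * B) :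
    HasExcessBound p B (ENNReal.ofReal M.γ * m)
      (randomUpdate (M.stepKernel π) (M.costUpdate ℓ) ζ) := by
  have := hζ.isMarkovKernel
  have := M.isMarkovKernel_stepKernel π
  have hG := M.measurable_costUpdate (ℓ := ℓ) hℓ
  refine ⟨isMarkovKernel_randomUpdate hG, fun s => ?_⟩
  refine eLpNorm_randomUpdate_le (fun _ => prob_le_one) hG (by fun_prop) hp (fun s s' z => ?_)
    hζ.eLpNorm_le s
  rw [Real.norm_of_nonneg (excess_nonneg _ _), Real.norm_of_nonneg (excess_nonneg _ _)]
  exact M.excess_costUpdate_le hR hK hB s s' z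

theorem policyValue_sub_fst {q : X × A → ℝ} (hq : BddMeasurable q) (ℓ : X → ℝ) (x : X) :
    policyValue π (fun s => q s - ℓ s.1) x = policyValue π q x - ℓ x := by
  simp only [policyValue]
  rw [integral_sub ((hq.prodMk_left x).integrable _) (integrable_const _)]
  simp

theorem meanFn_randomUpdate_costUpdate (hζ : HasBoundedMoment p ζ) (hp : 1 ≤ p)
    (hℓ : BddMeasurable ℓ) :
    meanFn (randomUpdate (M.stepKernel π) (M.costUpdate ℓ) ζ)
      = M.bellmanBackup fun x => policyValue π (meanFn ζ) x - ℓ x := by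
  have := M.isMarkovKernel_stepKernel π
  have hreward : BddMeasurable fun w : (X × A) × (X × A) => M.r w.1 - M.γ * ℓ w.2.1 :=
    (M.bddMeasurable_r.comp measurable_fst).sub ((hℓ.comp (by fun_prop)).const_mul M.γ)
  have hdiff : BddMeasurable fun s => meanFn ζ s - ℓ s.1 :=
    (hζ.bddMeasurable_meanFn hp).sub (hℓ.comp measurable_fst)
  ext s
  calc meanFn (randomUpdate (M.stepKernel π) (M.costUpdate ℓ) ζ) s
      = ∫ s', (M.r s - M.γ * ℓ s'.1 + M.γ * meanFn ζ s') ∂(M.stepKernel π s) :=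
        hζ.meanFn_randomUpdate_affine hp (M.stepKernel π) hreward M.γ s
    _ = ∫ s', (M.r s + M.γ * (meanFn ζ s' - ℓ s'.1)) ∂(M.stepKernel π s) := by
        congr with s'
        ring
    _ = M.r s + M.γ * ∫ s', (meanFn ζ s' - ℓ s'.1) ∂(M.stepKernel π s) := by
        rw [integral_add (integrable_const _) ((hdiff.integrable _).const_mul _),
          integral_const_mul]
        simp
    _ = M.bellmanBackup (fun x => policyValue π (meanFn ζ) x - ℓ x) s := by
        rw [M.integral_stepKernel π hdiff, bellmanBackup]
        simp only [policyValue_sub_fst π (hζ.bddMeasurable_meanFn hp)]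

theorem softEval_eq_randomUpdate (πref : Kernel X A) (τ : ℝ) (π : Kernel X A)
    (ζ : Kernel (X × A) ℝ) :
    M.softEval πref τ π ζ
      = randomUpdate (M.stepKernel π) (M.costUpdate (klCost πref τ π)) ζ := by
  unfold softEval randomUpdate costUpdate klCost
  congr 1
  ext w
  ring

end BellmanUpdate

section DiscountedReturn

variable {R : ℝ}

theorem summable_discountedReturn (ω : ℕ → X × A) : Summable fun t => M.γ ^ t * M.r (ω t) := by
  obtain ⟨R, hR⟩ := M.bddMeasurable_r.2
  refine Summable.of_norm_bounded
    ((summable_geometric_of_lt_one M.γ_pos.le M.γ_lt_one).mul_right R) fun t => ?_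
  rw [norm_mul, norm_pow, Real.norm_of_nonneg M.γ_pos.le]
  exact mul_le_mul_of_nonneg_left (hR _) (pow_nonneg M.γ_pos.le t)

theorem abs_discountedReturn_le (hR : ∀ s, |M.r s| ≤ R) (ω : ℕ → X × A) :
    |M.discountedReturn ω| ≤ R / (1 - M.γ) := by
  have hgeom := (hasSum_geometric_of_lt_one M.γ_pos.le M.γ_lt_one).mul_right R
  rw [inv_mul_eq_div] at hgeom
  refine tsum_of_norm_bounded (f := fun t => M.γ ^ t * M.r (ω t)) hgeom fun t => ?_
  rw [norm_mul, norm_pow, Real.norm_of_nonneg M.γ_pos.le]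
  exact mul_le_mul_of_nonneg_left (hR _) (pow_nonneg M.γ_pos.le t)

theorem discountedReturn_consSeq (s : X × A) (ω : ℕ → X × A) :
    M.discountedReturn (consSeq s ω) = M.r s + M.γ * M.discountedReturn ω := by
  rw [discountedReturn, (M.summable_discountedReturn _).tsum_eq_zero_add, discountedReturn,
    ← tsum_mul_left]
  simp [consSeq, pow_succ', mul_assoc]

theorem measurable_discountedReturn : Measurable M.discountedReturn := by
  have hr := M.bddMeasurable_r.1
  refine measurable_of_tendsto_metrizable
    (f := fun n ω => ∑ t ∈ Finset.range n, M.γ ^ t * M.r (ω t)) (fun n => by fun_prop) ?_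
  exact tendsto_pi_nhds.2 fun ω => (M.summable_discountedReturn ω).hasSum.tendsto_sum_nat

end DiscountedReturn

section ReturnDist

variable (π : Kernel X A) [IsMarkovKernel π] {p R B : ℝ}

theorem returnDist_eq_map_markovChain :
    haveI := M.isMarkovKernel_stepKernel π
    M.returnDist π = (markovChain (M.stepKernel π)).map M.discountedReturn :=
  dif_pos ‹IsMarkovKernel π›

theorem isMarkovKernel_returnDist : IsMarkovKernel (M.returnDist π) := by
  have := M.isMarkovKernel_stepKernel π
  rw [M.returnDist_eq_map_markovChain π]
  exact Kernel.IsMarkovKernel.map _ M.measurable_discountedReturn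

theorem ae_abs_le_returnDist (hR : ∀ s, |M.r s| ≤ R) (s : X × A) :
    ∀ᵐ z ∂(M.returnDist π s), |z| ≤ R / (1 - M.γ) := by
  rw [M.returnDist_eq_map_markovChain π, Kernel.map_apply _ M.measurable_discountedReturn,
    ae_map_iff M.measurable_discountedReturn.aemeasurable
      (measurableSet_le (by fun_prop) measurable_const)]
  exact ae_of_all _ (M.abs_discountedReturn_le hR)

theorem returnDist_eq_randomUpdate :
    M.returnDist π = randomUpdate (M.stepKernel π) (M.costUpdate 0) (M.returnDist π) := by
  have := M.isMarkovKernel_stepKernel π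
  have := M.isMarkovKernel_returnDist π
  have hret := M.measurable_discountedReturn
  have hG := M.measurable_costUpdate (ℓ := 0) measurable_const
  ext1 s
  refine Measure.ext_of_lintegral _ fun f hf => ?_
  have hcomp : Measurable fun ω => f (M.discountedReturn (consSeq s ω)) :=
    (hf.comp hret).comp (measurable_consSeq s)
  have hcons (s' : X × A) : ∫⁻ ω, f (M.discountedReturn (consSeq s ω))
      ∂(markovChain (M.stepKernel π) s')
        = ∫⁻ z, f (M.costUpdate 0 (s, (s', z))) ∂(M.returnDist π s') := by
    rw [M.returnDist_eq_map_markovChain π, Kernel.map_apply _ hret,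
      lintegral_map (by fun_prop) hret]
    simp [costUpdate, discountedReturn_consSeq]
  calc ∫⁻ z, f z ∂(M.returnDist π s)
      = ∫⁻ ω, f (M.discountedReturn (consSeq s ω))
          ∂((markovChain (M.stepKernel π) ∘ₖ M.stepKernel π) s) := by
        rw [M.returnDist_eq_map_markovChain π, Kernel.map_apply _ hret, lintegral_map hf hret,
          markovChain_apply_eq_map_consSeq, Kernel.map_apply _ (measurable_consSeq s),
          lintegral_map (f := fun ω => f (M.discountedReturn ω)) (by fun_prop)
            (measurable_consSeq s)]
    _ = ∫⁻ s', ∫⁻ z, f (M.costUpdate 0 (s, (s', z))) ∂(M.returnDist π s') ∂(M.stepKernel π s) := by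
        rw [Kernel.lintegral_comp _ _ _ hcomp]
        exact lintegral_congr hcons
    _ = ∫⁻ z, f z ∂(randomUpdate (M.stepKernel π) (M.costUpdate 0) (M.returnDist π) s) :=
        (lintegral_randomUpdate hG hf s).symm

theorem hasExcessBound_returnDist (hR : ∀ s, |M.r s| ≤ R) (hRB : R / (1 - M.γ) ≤ B) :
    HasExcessBound p B 0 (M.returnDist π) := by
  refine ⟨M.isMarkovKernel_returnDist π, fun s => (eLpNorm_eq_zero_of_ae_zero ?_).le⟩
  exact (M.ae_abs_le_returnDist π hR s).mono fun z hz => excess_eq_zero (hz.trans hRB)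

theorem hasBoundedMoment_returnDist (hp : 1 ≤ p) : HasBoundedMoment p (M.returnDist π) := by
  obtain ⟨R, hR⟩ := M.bddMeasurable_r.2
  exact (M.hasExcessBound_returnDist π hR (le_max_left _ 0)).hasBoundedMoment hp (le_max_right _ _)
    ENNReal.zero_ne_top

theorem bddMeasurable_actionValue : BddMeasurable (M.actionValue π) :=
  (M.hasBoundedMoment_returnDist π le_rfl).bddMeasurable_meanFn le_rfl

theorem actionValue_eq_bellmanBackup :
    M.actionValue π = M.bellmanBackup (policyValue π (M.actionValue π)) := by
  have h := M.meanFn_randomUpdate_costUpdate π (M.hasBoundedMoment_returnDist π le_rfl) le_rfl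
    (BddMeasurable.const 0)
  simp only [sub_zero] at h
  rw [actionValue]
  nth_rewrite 1 [M.returnDist_eq_randomUpdate π]
  exact h

end ReturnDist

variable {πref : Kernel X A} [IsMarkovKernel πref] {p B R Q c η σ τ : ℝ} {m : ℝ≥0∞} {q : X × A → ℝ}
  {ζ ζ₀ : Kernel (X × A) ℝ}

section SoftEval

theorem hasExcessBound_softEval_boltzmann (hp : 0 < p) (hq : BddMeasurable q)
    (hQ : ∀ s, |q s| ≤ Q) (hτ : 0 < τ) (hR : ∀ s, |M.r s| ≤ R)
    (hB : R + M.γ * (2 * Q) ≤ (1 - M.γ) * B) (hζ : HasExcessBound p B m ζ) :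
    HasExcessBound p B (ENNReal.ofReal M.γ * m)
      (M.softEval πref τ (boltzmann πref τ q) ζ) := by
  have := isMarkovKernel_boltzmann (πref := πref) hq hτ
  have hcost (x) : |klCost πref τ (boltzmann πref τ q) x| ≤ 2 * Q :=
    (abs_of_nonneg (klCost_nonneg hτ πref _ x)).trans_le (klCost_boltzmann_le_two_mul hq hτ hQ x)
  rw [softEval_eq_randomUpdate]
  exact M.hasExcessBound_randomUpdate_costUpdate _ hp hζ (bddMeasurable_klCost_boltzmann hq hτ).1
    hR hcost hB

theorem hasExcessBound_iterate_softEval_boltzmann (hp : 0 < p) (hq : BddMeasurable q)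
    (hQ : ∀ s, |q s| ≤ Q) (hτ : 0 < τ) (hR : ∀ s, |M.r s| ≤ R)
    (hB : R + M.γ * (2 * Q) ≤ (1 - M.γ) * B) (hζ : HasExcessBound p B m ζ) (n : ℕ) :
    HasExcessBound p B (ENNReal.ofReal M.γ ^ n * m)
      ((M.softEval πref τ (boltzmann πref τ q))^[n] ζ) := by
  induction n with
  | zero => simpa using hζ
  | succ n ih =>
    rw [Function.iterate_succ_apply', pow_succ', mul_assoc]
    exact M.hasExcessBound_softEval_boltzmann hp hq hQ hτ hR hB ih

theorem meanFn_softEval_boltzmann (hp : 1 ≤ p) (hq : BddMeasurable q) (hτ : 0 < τ)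
    (hζ : HasBoundedMoment p ζ) :
    meanFn (M.softEval πref τ (boltzmann πref τ q) ζ) = M.bellmanBackup fun x =>
      policyValue (boltzmann πref τ q) (meanFn ζ) x - klCost πref τ (boltzmann πref τ q) x := by
  have := isMarkovKernel_boltzmann (πref := πref) hq hτ
  rw [softEval_eq_randomUpdate]
  exact M.meanFn_randomUpdate_costUpdate _ hζ hp (bddMeasurable_klCost_boltzmann hq hτ)

end SoftEval

section Control

theorem meanFn_softControl (hp : 1 ≤ p) (hσ : 0 < σ) (hζ : HasBoundedMoment p ζ) :
    meanFn (M.softControl πref σ ζ) = M.softBellman πref σ (meanFn ζ) := by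
  have hq := hζ.bddMeasurable_meanFn hp
  rw [softControl, M.meanFn_softEval_boltzmann hp hq hσ hζ]
  simp only [klCost_boltzmann hq hσ, sub_sub_cancel]
  rfl

theorem abs_softBellman_le (hq : BddMeasurable q) (hQ : ∀ s, |q s| ≤ Q) (hσ : 0 < σ)
    (hR : ∀ s, |M.r s| ≤ R) (s : X × A) : |M.softBellman πref σ q s| ≤ R + M.γ * Q := by
  have hzero : M.softBellman πref σ (fun _ => 0) s = M.r s := by simp [softBellman, softValue]
  have hsub := (M.isSupLipschitz_softBellman πref hσ).abs_sub_le hq (BddMeasurable.const 0)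
    (by simpa using hQ) s
  rw [hzero] at hsub
  linarith [abs_sub_abs_le_abs_sub (M.softBellman πref σ q s) (M.r s), hR s]

theorem controlIterate_succ (n : ℕ) :
    M.controlIterate πref σ ζ₀ (n + 1) = M.softControl πref σ (M.controlIterate πref σ ζ₀ n) :=
  Function.iterate_succ_apply' _ _ _

variable (hp : 1 ≤ p) (hσ : 0 < σ) (hR : ∀ s, |M.r s| ≤ R) (hQR : R + M.γ * Q ≤ Q)
  (hB0 : 0 ≤ B) (hB : R + M.γ * (2 * Q) ≤ (1 - M.γ) * B) (hm : m ≠ ⊤)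
  (hζ₀ : HasExcessBound p B m ζ₀) (hQ : ∀ s, |meanFn ζ₀ s| ≤ Q)
include hp hσ hR hQR hB0 hB hm hζ₀ hQ

theorem controlIterate_bounds (n : ℕ) :
    HasExcessBound p B m (M.controlIterate πref σ ζ₀ n) ∧
      ∀ s, |meanFn (M.controlIterate πref σ ζ₀ n) s| ≤ Q := by
  induction n with
  | zero => exact ⟨hζ₀, hQ⟩
  | succ n ih =>
    obtain ⟨hexcess, hmean⟩ := ih
    have hmoment := hexcess.hasBoundedMoment hp hB0 hm
    have hq := hmoment.bddMeasurable_meanFn hp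
    rw [controlIterate_succ]
    have hstep := M.hasExcessBound_softEval_boltzmann (πref := πref) (by linarith) hq hmean hσ hR
      hB hexcess
    refine ⟨hstep.mono (mul_le_of_le_one_left zero_le (by simpa using M.γ_lt_one.le)),
      fun s => ?_⟩
    rw [M.meanFn_softControl hp hσ hmoment]
    exact (M.abs_softBellman_le hq hmean hσ hR s).trans hQR

theorem meanFn_controlIterate (n : ℕ) :
    meanFn (M.controlIterate πref σ ζ₀ n) = (M.softBellman πref σ)^[n] (meanFn ζ₀) := by
  induction n with
  | zero => rfl
  | succ n ih =>
    have hexcess := (M.controlIterate_bounds (πref := πref) hp hσ hR hQR hB0 hB hm hζ₀ hQ n).1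
    rw [controlIterate_succ, M.meanFn_softControl hp hσ (hexcess.hasBoundedMoment hp hB0 hm), ih,
      Function.iterate_succ_apply']

theorem exists_abs_meanFn_controlIterate_sub_qRef_le (hc : 0 < c)
    (hcov : IsCovered πref c (M.qSoft πref σ)) :
    ∃ n, ∀ s, |meanFn (M.controlIterate πref σ ζ₀ n) s - M.qRef πref s|
      ≤ (1 + M.γ * Real.log c⁻¹ / (1 - M.γ)) * σ := by
  obtain ⟨hsoft, hsoft_fix⟩ := M.qSoft_spec πref hσ
  obtain ⟨n, hn⟩ := (M.isSupLipschitz_softBellman πref hσ).exists_iterate_near M.γ_pos.le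
    M.γ_lt_one ((hζ₀.hasBoundedMoment hp hB0 hm).bddMeasurable_meanFn hp) hsoft hsoft_fix hσ
  refine ⟨n, fun s => ?_⟩
  rw [M.meanFn_controlIterate hp hσ hR hQR hB0 hB hm hζ₀ hQ n]
  calc _ ≤ σ + M.γ * (σ * Real.log c⁻¹) / (1 - M.γ) :=
        (abs_sub_le _ (M.qSoft πref σ s) _).trans
          (add_le_add (hn s) (M.abs_qSoft_sub_qRef_le hc hσ hcov s))
    _ = _ := by ring

end Control

section Evaluation

theorem IsCovered.log_inv_nonneg (hcov : IsCovered πref c q) (hc : 0 < c) (x : X) :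
    0 ≤ Real.log c⁻¹ :=
  Real.log_nonneg ((one_le_inv₀ hc).2 (ENNReal.ofReal_le_one.1 ((hcov x).trans prob_le_one)))

theorem IsCovered.softSlack_nonneg (hcov : IsCovered πref c q) (hc : 0 < c) (hτ : 0 < τ)
    (hη : 0 ≤ η) (x : X) : 0 ≤ softSlack c τ η := by
  have := hcov.log_inv_nonneg hc x
  unfold softSlack
  positivity

variable (hτ : 0 < τ) (hc : 0 < c) (hcov : IsCovered πref c (M.qRef πref))
include hτ hc hcov

theorem abs_meanFn_softEval_boltzmann_sub_qRef_le {D : ℝ} (hp : 1 ≤ p) (hq : BddMeasurable q)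
    (hη : ∀ s, |q s - M.qRef πref s| ≤ η) (hζ : HasBoundedMoment p ζ)
    (hD : ∀ s, |meanFn ζ s - M.qRef πref s| ≤ D) (s : X × A) :
    |meanFn (M.softEval πref τ (boltzmann πref τ q) ζ) s - M.qRef πref s|
      ≤ M.γ * (D + softSlack c τ η) := by
  obtain ⟨href, href_fix⟩ := M.qRef_spec πref
  have hmean := hζ.bddMeasurable_meanFn hp
  have := isMarkovKernel_boltzmann (πref := πref) hq hτ
  have hpolicy := isSupLipschitz_policyValue (boltzmann πref τ q)
  rw [M.meanFn_softEval_boltzmann hp hq hτ hζ]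
  nth_rewrite 1 [← href_fix]
  refine M.isSupLipschitz_bellmanBackup.abs_sub_le
    ((hpolicy.bddMeasurable hmean).sub (bddMeasurable_klCost_boltzmann hq hτ))
    ((isSupLipschitz_refValue πref).bddMeasurable href) (fun x => ?_) s
  have hnear := abs_le.1 (hpolicy.abs_sub_le hmean href hD x)
  have hloss := abs_le.1 (abs_policyValue_sub_klCost_sub_refValue_le hq href hη hτ hc hcov x)
  exact abs_le.2 ⟨by linarith, by linarith⟩

theorem abs_meanFn_iterate_softEval_boltzmann_sub_qRef_le (hp : 1 ≤ p) (hB0 : 0 ≤ B)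
    (hm : m ≠ ⊤) (hR : ∀ s, |M.r s| ≤ R) (hB : R + M.γ * (2 * Q) ≤ (1 - M.γ) * B)
    (hζ : HasExcessBound p B m ζ) (hQ : ∀ s, |meanFn ζ s| ≤ Q)
    (hη : ∀ s, |meanFn ζ s - M.qRef πref s| ≤ η) (n : ℕ) (s : X × A) :
    |meanFn ((M.softEval πref τ (boltzmann πref τ (meanFn ζ)))^[n] ζ) s - M.qRef πref s|
      ≤ softSlack c τ η / (1 - M.γ) := by
  have hγ := M.γ_lt_one
  have hη0 := (abs_nonneg _).trans (hη s)
  have hslack := hcov.softSlack_nonneg hc hτ hη0 s.1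
  have hq := (hζ.hasBoundedMoment hp hB0 hm).bddMeasurable_meanFn hp
  set D := softSlack c τ η / (1 - M.γ)
  have hDγ : D * (1 - M.γ) = softSlack c τ η := div_mul_cancel₀ _ (by linarith)
  induction n generalizing s with
  | zero =>
    refine (hη s).trans ((le_div_iff₀ (by linarith)).2 ?_)
    have hlog := mul_nonneg hτ.le (hcov.log_inv_nonneg hc s.1)
    rw [softSlack]
    nlinarith [M.γ_pos]
  | succ n ih =>
    have hexcess := M.hasExcessBound_iterate_softEval_boltzmann (πref := πref) (by linarith) hq hQ
      hτ hR hB hζ n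
    have hmoment := hexcess.hasBoundedMoment hp hB0
      (ENNReal.mul_ne_top (ENNReal.pow_ne_top ENNReal.ofReal_ne_top) hm)
    rw [Function.iterate_succ_apply']
    refine (M.abs_meanFn_softEval_boltzmann_sub_qRef_le hτ hc hcov hp hq hη hmoment ih s).trans ?_
    nlinarith

theorem isRefOptimal_boltzmann (hq : BddMeasurable q) (hη : ∀ s, |q s - M.qRef πref s| ≤ η) :
    M.IsRefOptimal πref (M.γ * softSlack c τ η / (1 - M.γ)) (boltzmann πref τ q) := by
  have hπ := isMarkovKernel_boltzmann (πref := πref) hq hτ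
  obtain ⟨href, href_fix⟩ := M.qRef_spec πref
  have hact := M.bddMeasurable_actionValue (boltzmann πref τ q)
  refine ⟨hπ, fun s => sub_le_comm.1 ?_⟩
  refine le_div_of_self_improving M.γ_lt_one ((href.sub hact).2.imp fun _ h s => (abs_le.1 (h s)).2)
    (fun e he s => ?_) s
  have hpolicy := isSupLipschitz_policyValue (boltzmann πref τ q)
  have hgap (x) : refValue πref (M.qRef πref) x
      ≤ policyValue (boltzmann πref τ q) (M.actionValue (boltzmann πref τ q)) x
        + (softSlack c τ η + e) := by
    have hnear := BddMeasurable.integral_le_add (href.prodMk_left x) (hact.prodMk_left x)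
      (fun a => sub_le_iff_le_add'.1 (he (x, a))) (boltzmann πref τ q x)
    have hloss := refValue_le_policyValue_boltzmann_add hq href hη hτ hc hcov x
    rw [policyValue] at hloss ⊢
    linarith
  have hbackup := M.bellmanBackup_le_add ((isSupLipschitz_refValue πref).bddMeasurable href)
    (hpolicy.bddMeasurable hact) hgap s
  rw [← M.actionValue_eq_bellmanBackup] at hbackup
  have hfix : M.bellmanBackup (refValue πref (M.qRef πref)) s = M.qRef πref s :=
    congrFun href_fix s
  linarith

end Evaluation

end MDP

section Coupling

variable {α β : Type*} [MeasurableSpace α] [MeasurableSpace β]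

theorem exists_map_fst_eq_and_map_snd_eq {μ : Measure α} {ν : Measure β} [IsFiniteMeasure μ]
    [IsFiniteMeasure ν] (h : μ Set.univ = ν Set.univ) :
    ∃ κ : Measure (α × β), κ.map Prod.fst = μ ∧ κ.map Prod.snd = ν := by
  refine ⟨(μ Set.univ)⁻¹ • μ.prod ν, ?_⟩
  rw [Measure.map_smul, Measure.map_smul, Measure.map_fst_prod, Measure.map_snd_prod, ← h]
  rcases eq_or_ne (μ Set.univ) 0 with h0 | h0
  · rw [Measure.measure_univ_eq_zero.1 h0, Measure.measure_univ_eq_zero.1 (h.symm.trans h0)]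
    simp
  · simp [smul_smul, ENNReal.inv_mul_cancel h0 (measure_ne_top μ _)]

theorem eLpNorm_add_measure_le {f : α → ℝ} {μ ν : Measure α} {p : ℝ} (hp : 1 ≤ p) :
    eLpNorm f (ENNReal.ofReal p) (μ + ν)
      ≤ eLpNorm f (ENNReal.ofReal p) μ + eLpNorm f (ENNReal.ofReal p) ν := by
  have hp0 : 0 < p := by linarith
  have h := ENNReal.rpow_add_rpow_le_add (eLpNorm f (ENNReal.ofReal p) μ)
    (eLpNorm f (ENNReal.ofReal p) ν) hp
  refine ((eLpNorm_le_iff_lintegral_le hp0).2 ?_).trans h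
  rw [lintegral_add_measure, one_div, ENNReal.rpow_inv_rpow hp0.ne']
  exact add_le_add ((eLpNorm_le_iff_lintegral_le hp0).1 le_rfl)
    ((eLpNorm_le_iff_lintegral_le hp0).1 le_rfl)

variable {p : ℝ} {μ ν : Measure ℝ}

theorem wass_le_eLpNorm_sub (hp : 0 < p) {κ : Measure (ℝ × ℝ)} (hfst : κ.map Prod.fst = μ)
    (hsnd : κ.map Prod.snd = ν) :
    wass p μ ν ≤ eLpNorm (fun z => z.1 - z.2) (ENNReal.ofReal p) κ := by
  rw [eLpNorm_eq_lintegral_rpow_enorm_toReal (by simpa using hp) ENNReal.ofReal_ne_top,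
    ENNReal.toReal_ofReal hp.le]
  refine ENNReal.rpow_le_rpow ((iInf₂_le κ ⟨hfst, hsnd⟩).trans_eq (lintegral_congr fun z => ?_))
    (by positivity)
  rw [Real.enorm_eq_ofReal_abs, ENNReal.ofReal_rpow_of_nonneg (abs_nonneg _) hp.le]

theorem wass_le_of_map_le [IsProbabilityMeasure μ] [IsProbabilityMeasure ν] (hp : 1 ≤ p)
    {κ : Measure (ℝ × ℝ)} [IsFiniteMeasure κ] (hfst : κ.map Prod.fst ≤ μ)
    (hsnd : κ.map Prod.snd ≤ ν) :
    wass p μ ν ≤ eLpNorm (fun z => z.1 - z.2) (ENNReal.ofReal p) κ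
      + (eLpNorm id (ENNReal.ofReal p) (μ - κ.map Prod.fst)
        + eLpNorm id (ENNReal.ofReal p) (ν - κ.map Prod.snd)) := by
  have hmass : (μ - κ.map Prod.fst) Set.univ = (ν - κ.map Prod.snd) Set.univ := by
    rw [Measure.sub_apply .univ hfst, Measure.sub_apply .univ hsnd,
      Measure.map_apply measurable_fst .univ, Measure.map_apply measurable_snd .univ]
    simp
  have := isFiniteMeasure_of_le _ (Measure.sub_le (μ := μ) (ν := κ.map Prod.fst))
  have := isFiniteMeasure_of_le _ (Measure.sub_le (μ := ν) (ν := κ.map Prod.snd))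
  obtain ⟨κ', hfst', hsnd'⟩ := exists_map_fst_eq_and_map_snd_eq hmass
  have hrest : eLpNorm (fun z => z.1 - z.2) (ENNReal.ofReal p) κ'
      ≤ eLpNorm id (ENNReal.ofReal p) (μ - κ.map Prod.fst)
        + eLpNorm id (ENNReal.ofReal p) (ν - κ.map Prod.snd) := by
    rw [← hfst', ← hsnd', eLpNorm_map_measure (by fun_prop) (by fun_prop),
      eLpNorm_map_measure (by fun_prop) (by fun_prop)]
    exact eLpNorm_sub_le (by fun_prop) (by fun_prop) (by simpa using hp)
  refine (wass_le_eLpNorm_sub (by linarith) (κ := κ + κ') ?_ ?_).trans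
    ((eLpNorm_add_measure_le hp).trans (add_le_add_right hrest _))
  · rw [Measure.map_add _ _ measurable_fst, hfst', add_comm, Measure.sub_add_cancel_of_le hfst]
  · rw [Measure.map_add _ _ measurable_snd, hsnd', add_comm, Measure.sub_add_cancel_of_le hsnd]

theorem eLpNorm_id_sub_le [IsProbabilityMeasure μ] {ρ : Measure ℝ} [IsFiniteMeasure ρ]
    (hρ : ρ ≤ μ) (hp : 1 ≤ p) {B : ℝ} (hB : 0 ≤ B) :
    eLpNorm id (ENNReal.ofReal p) (μ - ρ)
      ≤ ENNReal.ofReal B * (1 - ρ Set.univ) ^ (1 / p)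
        + eLpNorm (excess B) (ENNReal.ofReal p) μ := by
  refine (eLpNorm_le_add_eLpNorm_excess hp hB measurable_id).trans ?_
  rw [Measure.sub_apply .univ hρ, measure_univ]
  exact add_le_add_right (eLpNorm_mono_measure _ Measure.sub_le) _

theorem wass_le_add_eLpNorm_excess [IsProbabilityMeasure μ] [IsProbabilityMeasure ν] (hp : 1 ≤ p)
    {B : ℝ} (hB : 0 ≤ B) {κ : Measure (ℝ × ℝ)} [IsFiniteMeasure κ] (hfst : κ.map Prod.fst ≤ μ)
    (hsnd : κ.map Prod.snd ≤ ν) :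
    wass p μ ν ≤ eLpNorm (fun z => z.1 - z.2) (ENNReal.ofReal p) κ
      + 2 * ENNReal.ofReal B * (1 - κ Set.univ) ^ (1 / p)
      + (eLpNorm (excess B) (ENNReal.ofReal p) μ + eLpNorm (excess B) (ENNReal.ofReal p) ν) := by
  have hμ := eLpNorm_id_sub_le hfst hp hB
  have hν := eLpNorm_id_sub_le hsnd hp hB
  rw [Measure.map_apply measurable_fst .univ, Set.preimage_univ] at hμ
  rw [Measure.map_apply measurable_snd .univ, Set.preimage_univ] at hν
  refine (wass_le_of_map_le hp hfst hsnd).trans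
    ((add_le_add_right (add_le_add hμ hν) _).trans_eq ?_)
  ring

theorem eLpNorm_fst_sub_snd_prod_le [IsProbabilityMeasure μ] [IsProbabilityMeasure ν]
    (hp : 1 ≤ p) :
    eLpNorm (fun z : ℝ × ℝ => z.1 - z.2) (ENNReal.ofReal p) (μ.prod ν)
      ≤ eLpNorm id (ENNReal.ofReal p) μ + eLpNorm id (ENNReal.ofReal p) ν :=
  (eLpNorm_sub_le measurable_fst.aestronglyMeasurable measurable_snd.aestronglyMeasurable
    (by simpa using hp)).trans_eq (congrArg₂ _
      (eLpNorm_comp_measurePreserving (g := id) (by fun_prop) measurePreserving_fst)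
      (eLpNorm_comp_measurePreserving (g := id) (by fun_prop) measurePreserving_snd))

end Coupling

section Survival

open scoped NNReal

variable {S : Type*} [MeasurableSpace S] (k : Kernel S S) {w : S → ℝ≥0}

/-- The probability that the chain with kernel `k`, started at `s` and killed at each newly entered
state `s'` with probability `1 - w s'`, survives `n` steps. -/
noncomputable def survival (w : S → ℝ≥0) : ℕ → S → ℝ≥0∞
  | 0, _ => 1
  | n + 1, s => ∫⁻ s', w s' * survival w n s' ∂(k s)

theorem measurable_survival (hw : Measurable w) (n : ℕ) : Measurable (survival k w n) := by
  induction n with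
  | zero => exact measurable_const
  | succ n ih => exact (hw.coe_nnreal_ennreal.mul ih).lintegral_kernel

variable [IsMarkovKernel k]

theorem survival_le_one (hw : ∀ s, w s ≤ 1) (n : ℕ) (s : S) : survival k w n s ≤ 1 := by
  induction n generalizing s with
  | zero => exact le_rfl
  | succ n ih =>
    calc survival k w (n + 1) s ≤ ∫⁻ _, 1 ∂(k s) := lintegral_mono fun s' =>
          mul_le_one' (ENNReal.coe_le_one_iff.2 (hw s')) (ih s')
      _ = 1 := by simp

theorem tendsto_survival {ι : Type*} {l : Filter ι} [l.IsCountablyGenerated]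
    {w : ι → S → ℝ≥0} (hw : ∀ᶠ i in l, Measurable (w i)) (hw1 : ∀ᶠ i in l, ∀ s, w i s ≤ 1)
    (hlim : ∀ s, Tendsto (fun i => w i s) l (𝓝 1)) (n : ℕ) (s : S) :
    Tendsto (fun i => survival k (w i) n s) l (𝓝 1) := by
  induction n generalizing s with
  | zero => exact tendsto_const_nhds
  | succ n ih =>
    have hone : 1 = ∫⁻ _ : S, (1 : ℝ≥0∞) ∂(k s) := by simp
    rw [hone]
    refine tendsto_lintegral_filter_of_dominated_convergence (fun _ => 1) ?_ ?_ (by simp) ?_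
    · filter_upwards [hw] with i hi
      exact hi.coe_nnreal_ennreal.mul (measurable_survival k hi n)
    · filter_upwards [hw1] with i hi
      exact ae_of_all _ fun s' =>
        mul_le_one' (ENNReal.coe_le_one_iff.2 (hi s')) (survival_le_one k hi n s')
    · refine ae_of_all _ fun s' => ?_
      simpa using ENNReal.Tendsto.mul (ENNReal.tendsto_coe.2 (hlim s')) (by simp) (ih s') (by simp)

end Survival

namespace MDP

open scoped NNReal

variable {X A : Type*} [MeasurableSpace X] [MeasurableSpace A]

section CoupledIterate

variable (M : MDP X A) {p B R b : ℝ} {m : ℝ≥0∞} {ζ : Kernel (X × A) ℝ} {ℓ : X → ℝ} {w : X → ℝ≥0}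

/-- The joint update of a pair of returns along the same transition, where the cost `ℓ` is charged
to the first return only. -/
noncomputable def coupledUpdate (ℓ : X → ℝ) (v : (X × A) × ((X × A) × (ℝ × ℝ))) : ℝ × ℝ :=
  (M.costUpdate ℓ (v.1, (v.2.1, v.2.2.1)), M.costUpdate 0 (v.1, (v.2.1, v.2.2.2)))

theorem measurable_coupledUpdate (hℓ : Measurable ℓ) : Measurable (M.coupledUpdate ℓ) := by
  have hfst := M.measurable_costUpdate (ℓ := ℓ) hℓ
  have hsnd := M.measurable_costUpdate (ℓ := 0) measurable_const
  unfold coupledUpdate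
  fun_prop

theorem excess_coupledUpdate_sub_le (hb : ∀ x, |M.γ * ℓ x| ≤ (1 - M.γ) * b) (s s' : X × A)
    (z : ℝ × ℝ) :
    excess b ((M.coupledUpdate ℓ (s, (s', z))).1 - (M.coupledUpdate ℓ (s, (s', z))).2)
      ≤ M.γ * excess b (z.1 - z.2) := by
  have hdiff : (M.coupledUpdate ℓ (s, (s', z))).1 - (M.coupledUpdate ℓ (s, (s', z))).2
      = -(M.γ * ℓ s'.1) + M.γ * (z.1 - z.2) := by
    simp only [coupledUpdate, costUpdate, Pi.zero_apply]
    ring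
  rw [hdiff]
  exact excess_affine_le M.γ_pos.le ((abs_neg _).trans_le (hb s'.1)) _

theorem lintegral_stepKernel (π : Kernel X A) [IsSFiniteKernel π] {f : X × A → ℝ≥0∞}
    (hf : Measurable f) (s : X × A) :
    ∫⁻ s', f s' ∂(M.stepKernel π s) = ∫⁻ x, ∫⁻ a, f (x, a) ∂(π x) ∂(M.P s) := by
  have := M.markov_P
  exact Kernel.lintegral_compProd _ _ _ hf

theorem stepKernel_mono {π π' : Kernel X A} [IsSFiniteKernel π] [IsSFiniteKernel π']
    (h : ∀ x, π x ≤ π' x) (s : X × A) : M.stepKernel π s ≤ M.stepKernel π' s := by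
  refine Measure.le_iff.2 fun t ht => ?_
  have hind : Measurable (t.indicator (1 : X × A → ℝ≥0∞)) := measurable_one.indicator ht
  rw [← lintegral_indicator_one ht, ← lintegral_indicator_one ht, lintegral_stepKernel M π hind,
    lintegral_stepKernel M π' hind]
  exact lintegral_mono fun x => lintegral_mono' (h x) le_rfl

variable (π πs : Kernel X A) [IsMarkovKernel π] [IsMarkovKernel πs]

/-- The policy `πs` scaled by the survival probability `w x` at each state `x`. -/
noncomputable def killedPolicy (w : X → ℝ≥0) : Kernel X A := Kernel.withDensity πs fun x _ => w x

instance : IsSFiniteKernel (killedPolicy πs w) := by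
  unfold killedPolicy
  infer_instance

instance : IsSFiniteKernel (M.stepKernel (killedPolicy πs w)) := by
  have := M.markov_P
  unfold stepKernel
  infer_instance

variable {πs}

theorem killedPolicy_apply (hw : Measurable w) (x : X) : killedPolicy πs w x = w x • πs x := by
  rw [killedPolicy, Kernel.withDensity_apply _ (by fun_prop), withDensity_const]
  rfl

theorem killedPolicy_le (hw : Measurable w) (hw1 : ∀ x, w x ≤ 1) (x : X) :
    killedPolicy πs w x ≤ πs x := by
  rw [killedPolicy_apply hw]
  exact Measure.le_iff'.2 fun t => mul_le_of_le_one_left zero_le (ENNReal.coe_le_one_iff.2 (hw1 x))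

/-- The joint law of an iterate of the evaluation operator started from `ζ` and of the return of
`πs`, on the event that the two policies have taken the same actions. It is built for an arbitrary
lower bound `w` for the overlap of the two policies. -/
noncomputable def coupledIterate (πs : Kernel X A) [IsMarkovKernel πs] (w : X → ℝ≥0) (ℓ : X → ℝ)
    (ζ : Kernel (X × A) ℝ) (n : ℕ) : Kernel (X × A) (ℝ × ℝ) :=
  (randomUpdate (M.stepKernel (killedPolicy πs w)) (M.coupledUpdate ℓ))^[n] (ζ ×ₖ M.returnDist πs)

variable {π}

section Markov

variable [IsMarkovKernel ζ]

theorem map_fst_coupledIterate_le (hℓ : Measurable ℓ) (hw : Measurable w)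
    (hle : ∀ x, w x • πs x ≤ π x) (n : ℕ) (s : X × A) :
    (M.coupledIterate πs w ℓ ζ n s).map Prod.fst
      ≤ (randomUpdate (M.stepKernel π) (M.costUpdate ℓ))^[n] ζ s := by
  have := M.isMarkovKernel_stepKernel π
  have := M.isMarkovKernel_returnDist πs
  have hπ (x) : killedPolicy πs w x ≤ π x := (killedPolicy_apply hw x).trans_le (hle x)
  refine map_iterate_randomUpdate_le (M.stepKernel_mono hπ) measurable_fst (fun s => ?_)
    (M.measurable_coupledUpdate hℓ) (M.measurable_costUpdate hℓ) (fun _ _ _ => rfl) n s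
  rw [Kernel.prod_apply, Measure.map_fst_prod]
  simp

theorem map_snd_coupledIterate_le (hℓ : Measurable ℓ) (hw : Measurable w)
    (hw1 : ∀ x, w x ≤ 1) (n : ℕ) (s : X × A) :
    (M.coupledIterate πs w ℓ ζ n s).map Prod.snd ≤ M.returnDist πs s := by
  have := M.isMarkovKernel_stepKernel πs
  have := M.isMarkovKernel_returnDist πs
  have hfix : (randomUpdate (M.stepKernel πs) (M.costUpdate 0))^[n] (M.returnDist πs)
      = M.returnDist πs :=
    Function.iterate_fixed (M.returnDist_eq_randomUpdate πs).symm n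
  rw [← hfix]
  refine map_iterate_randomUpdate_le (M.stepKernel_mono (killedPolicy_le hw hw1)) measurable_snd
    (fun s => ?_) (M.measurable_coupledUpdate hℓ) (M.measurable_costUpdate measurable_const)
    (fun _ _ _ => rfl) n s
  rw [Kernel.prod_apply, Measure.map_snd_prod]
  simp

theorem coupledIterate_apply_univ (hℓ : Measurable ℓ) (hw : Measurable w) (n : ℕ) (s : X × A) :
    M.coupledIterate πs w ℓ ζ n s Set.univ
      = survival (M.stepKernel πs) (fun s' => w s'.1) n s := by
  have := M.isMarkovKernel_returnDist πs
  unfold coupledIterate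
  induction n generalizing s with
  | zero => simp [survival]
  | succ n ih =>
    have hsurv := measurable_survival (M.stepKernel πs) (w := fun s' => w s'.1) (by fun_prop) n
    rw [Function.iterate_succ_apply', randomUpdate_apply_univ (M.measurable_coupledUpdate hℓ)]
    simp only [ih, survival]
    rw [M.lintegral_stepKernel _ hsurv, M.lintegral_stepKernel _ (by fun_prop)]
    refine lintegral_congr fun x => ?_
    rw [killedPolicy_apply hw, ENNReal.smul_def, lintegral_smul_measure, smul_eq_mul]
    exact (lintegral_const_mul _ (by fun_prop)).symm

theorem coupledIterate_apply_univ_le_one (hℓ : Measurable ℓ) (hw : Measurable w)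
    (hw1 : ∀ x, w x ≤ 1) (n : ℕ) (s : X × A) :
    M.coupledIterate πs w ℓ ζ n s Set.univ ≤ 1 := by
  have := M.isMarkovKernel_stepKernel πs
  rw [coupledIterate_apply_univ M hℓ hw]
  exact survival_le_one (M.stepKernel πs) (fun s' => hw1 s'.1) n s

theorem eLpNorm_excess_coupledIterate_le (hℓ : Measurable ℓ) (hw : Measurable w)
    (hw1 : ∀ x, w x ≤ 1) (hb : ∀ x, |M.γ * ℓ x| ≤ (1 - M.γ) * b) (hp : 0 < p) {C : ℝ≥0∞}
    (hC : ∀ s, eLpNorm (fun z : ℝ × ℝ => excess b (z.1 - z.2)) (ENNReal.ofReal p)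
      ((ζ s).prod (M.returnDist πs s)) ≤ C) (n : ℕ) (s : X × A) :
    eLpNorm (fun z => excess b (z.1 - z.2)) (ENNReal.ofReal p) (M.coupledIterate πs w ℓ ζ n s)
      ≤ ENNReal.ofReal M.γ ^ n * C := by
  have := M.isMarkovKernel_stepKernel πs
  have := M.isMarkovKernel_returnDist πs
  have hmass (s) : M.stepKernel (killedPolicy πs w) s Set.univ ≤ 1 :=
    (M.stepKernel_mono (killedPolicy_le hw hw1) s Set.univ).trans prob_le_one
  refine eLpNorm_iterate_randomUpdate_le hmass (M.measurable_coupledUpdate hℓ) (by fun_prop) hp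
    (fun s s' z => ?_) (fun s => ?_) n s
  · rw [Real.norm_of_nonneg (excess_nonneg _ _), Real.norm_of_nonneg (excess_nonneg _ _)]
    exact M.excess_coupledUpdate_sub_le hb s s' z
  · rw [Kernel.prod_apply]
    exact hC s

end Markov

theorem eLpNorm_sub_coupledIterate_le (hp : 1 ≤ p) (hℓ : Measurable ℓ) (hw : Measurable w)
    (hw1 : ∀ x, w x ≤ 1) (hb : ∀ x, |M.γ * ℓ x| ≤ (1 - M.γ) * b) (hb0 : 0 ≤ b) (hB : 0 ≤ B)
    (hR : ∀ s, |M.r s| ≤ R) (hRB : R / (1 - M.γ) ≤ B) (hζ : HasExcessBound p B m ζ) (n : ℕ)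
    (s : X × A) :
    eLpNorm (fun z => z.1 - z.2) (ENNReal.ofReal p) (M.coupledIterate πs w ℓ ζ n s)
      ≤ ENNReal.ofReal b + ENNReal.ofReal M.γ ^ n * (2 * ENNReal.ofReal B + m) := by
  have hret := M.hasExcessBound_returnDist (p := p) πs hR hRB
  have := hζ.isMarkovKernel
  have := hret.isMarkovKernel
  have hinit (s) : eLpNorm (fun z : ℝ × ℝ => excess b (z.1 - z.2)) (ENNReal.ofReal p)
      ((ζ s).prod (M.returnDist πs s)) ≤ 2 * ENNReal.ofReal B + m :=
    calc _ ≤ eLpNorm id (ENNReal.ofReal p) (ζ s)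
            + eLpNorm id (ENNReal.ofReal p) (M.returnDist πs s) :=
          (eLpNorm_excess_le hb0).trans (eLpNorm_fst_sub_snd_prod_le hp)
      _ ≤ (ENNReal.ofReal B + m) + (ENNReal.ofReal B + 0) :=
          add_le_add (hζ.eLpNorm_id_le hp hB s) (hret.eLpNorm_id_le hp hB s)
      _ = 2 * ENNReal.ofReal B + m := by ring
  refine (eLpNorm_le_add_eLpNorm_excess hp hb0 (by fun_prop)).trans (add_le_add ?_
    (M.eLpNorm_excess_coupledIterate_le hℓ hw hw1 hb (by linarith) hinit n s))
  exact mul_le_of_le_one_right zero_le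
    (ENNReal.rpow_le_one (M.coupledIterate_apply_univ_le_one hℓ hw hw1 n s) (by positivity))

theorem wass_iterate_randomUpdate_returnDist_le (hp : 1 ≤ p) (hℓ : Measurable ℓ)
    (hw : Measurable w) (hw1 : ∀ x, w x ≤ 1) (hle : ∀ x, w x • πs x ≤ π x)
    (hb : ∀ x, |M.γ * ℓ x| ≤ (1 - M.γ) * b) (hb0 : 0 ≤ b) (hB : 0 ≤ B)
    (hR : ∀ s, |M.r s| ≤ R) (hRB : R / (1 - M.γ) ≤ B) (hζ : HasExcessBound p B m ζ) {n : ℕ}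
    {m' : ℝ≥0∞} (hζn : HasExcessBound p B m'
      ((randomUpdate (M.stepKernel π) (M.costUpdate ℓ))^[n] ζ)) (s : X × A) :
    wass p ((randomUpdate (M.stepKernel π) (M.costUpdate ℓ))^[n] ζ s) (M.returnDist πs s)
      ≤ ENNReal.ofReal b + ENNReal.ofReal M.γ ^ n * (2 * ENNReal.ofReal B + m) + m'
        + 2 * ENNReal.ofReal B
          * (1 - survival (M.stepKernel πs) (fun s' => w s'.1) n s) ^ (1 / p) := by
  have hret := M.hasExcessBound_returnDist (p := p) πs hR hRB
  have := hζ.isMarkovKernel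
  have := hζn.isMarkovKernel
  have := hret.isMarkovKernel
  have : IsFiniteMeasure (M.coupledIterate πs w ℓ ζ n s) :=
    ⟨(M.coupledIterate_apply_univ_le_one hℓ hw hw1 n s).trans_lt ENNReal.one_lt_top⟩
  have hdist := M.eLpNorm_sub_coupledIterate_le (πs := πs) hp hℓ hw hw1 hb hb0 hB hR hRB hζ n s
  have hwass := wass_le_add_eLpNorm_excess hp hB (M.map_fst_coupledIterate_le hℓ hw hle n s)
    (M.map_snd_coupledIterate_le (ζ := ζ) hℓ hw hw1 n s)
  rw [M.coupledIterate_apply_univ hℓ hw] at hwass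
  refine hwass.trans ((add_le_add (add_le_add_left hdist _)
    (add_le_add (hζn.eLpNorm_le s) (hret.eLpNorm_le s))).trans_eq ?_)
  ring

end CoupledIterate

theorem IsCovered.measure_ne_zero {πref : Kernel X A} {q : X × A → ℝ} {c : ℝ}
    (hcov : IsCovered πref c q) (hc : 0 < c) (x : X) : πref x (optActions πref q x) ≠ 0 :=
  ((ENNReal.ofReal_pos.2 hc).trans_le (hcov x)).ne'

section FilteredPolicy

variable {πref : Kernel X A} [IsMarkovKernel πref] {q q' : X × A → ℝ} {τ η : ℝ} {x : X}

theorem measurable_measure_optActions (hq : BddMeasurable q) :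
    Measurable fun x => πref x (optActions πref q x) :=
  Kernel.measurable_kernel_prodMk_left (measurableSet_mem_optActions πref hq)

theorem filteredPolicy_apply (hq : BddMeasurable q) (x : X) :
    filteredPolicy πref q x = (πref x)[|optActions πref q x] := by
  classical
  have happly : filteredPolicy πref q x
      = (πref x).withDensity ((optActions πref q x).indicator fun _ =>
        (πref x (optActions πref q x))⁻¹) :=
    Kernel.withDensity_apply _ (Measurable.ite (measurableSet_mem_optActions πref hq)
      ((measurable_measure_optActions hq).inv.comp measurable_fst) measurable_const) _
  rw [happly, withDensity_indicator (measurableSet_optActions hq x), withDensity_const]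
  rfl

theorem isMarkovKernel_filteredPolicy (hq : BddMeasurable q)
    (hpos : ∀ x, πref x (optActions πref q x) ≠ 0) : IsMarkovKernel (filteredPolicy πref q) :=
  ⟨fun x => (filteredPolicy_apply (πref := πref) hq x).symm ▸ cond_isProbabilityMeasure (hpos x)⟩

/-- A lower bound for the density, with respect to the filtered policy of `q`, of the
Boltzmann-Gibbs policies at temperature `τ` of the functions within `η` of `q`. -/
noncomputable def overlap (πref : Kernel X A) (τ η : ℝ) (q : X × A → ℝ) (x : X) : ℝ≥0 :=
  (Real.exp ((refValue πref q x - softValue πref τ q x - 2 * η) / τ)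
    * (πref x).real (optActions πref q x)).toNNReal

theorem measurable_overlap (hq : BddMeasurable q) (hτ : 0 < τ) (η : ℝ) :
    Measurable (overlap πref τ η q) := by
  have hsoft := ((isSupLipschitz_softValue πref hτ).bddMeasurable hq).1
  have href := ((isSupLipschitz_refValue πref).bddMeasurable hq).1
  have hopt := (measurable_measure_optActions (πref := πref) hq).ennreal_toReal
  unfold overlap Measure.real
  fun_prop

theorem overlap_smul_filteredPolicy_le (hq : BddMeasurable q) (hq' : BddMeasurable q')
    (hτ : 0 < τ) (hη : ∀ s, |q' s - q s| ≤ η) (hpos : πref x (optActions πref q x) ≠ 0) :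
    overlap πref τ η q x • filteredPolicy πref q x ≤ boltzmann πref τ q' x := by
  have hdensity : (overlap πref τ η q x : ℝ≥0∞) * (πref x (optActions πref q x))⁻¹
      = ENNReal.ofReal (Real.exp ((refValue πref q x - softValue πref τ q x - 2 * η) / τ)) := by
    change ENNReal.ofReal _ * _ = _
    rw [ENNReal.ofReal_mul (Real.exp_pos _).le, ofReal_measureReal, mul_assoc,
      ENNReal.mul_inv_cancel hpos (measure_ne_top _ _), mul_one]
  rw [filteredPolicy_apply hq, boltzmann_apply hq' hτ, ENNReal.smul_def,
    ProbabilityTheory.cond, smul_smul,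
    hdensity, ← withDensity_const, ← withDensity_indicator (measurableSet_optActions hq x)]
  refine withDensity_mono (ae_of_all _ (Set.indicator_le' (fun a ha => ?_) fun _ _ => zero_le))
  have hmax : q (x, a) = refValue πref q x := ha
  have hnear := abs_le.1 (hη (x, a))
  have hsoft := abs_le.1 ((isSupLipschitz_softValue πref hτ).abs_sub_le hq' hq hη x)
  refine ENNReal.ofReal_le_ofReal (Real.exp_le_exp.2 (div_le_div_of_nonneg_right ?_ hτ.le))
  linarith

theorem overlap_le_one (hq : BddMeasurable q) (hτ : 0 < τ) (hη : 0 ≤ η)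
    (hpos : ∀ x, πref x (optActions πref q x) ≠ 0) (x : X) : overlap πref τ η q x ≤ 1 := by
  have := isMarkovKernel_filteredPolicy hq hpos
  have := isMarkovKernel_boltzmann (πref := πref) hq hτ
  have hle := overlap_smul_filteredPolicy_le (η := η) hq hq hτ (fun s => by simpa using hη)
    (hpos x) Set.univ
  rwa [Measure.smul_apply, measure_univ, measure_univ, ENNReal.smul_def, smul_eq_mul, mul_one,
    ENNReal.coe_le_one_iff] at hle

theorem tendsto_integral_exp_sub_refValue (hq : BddMeasurable q) (x : X) :
    Tendsto (fun τ : ℝ => ∫ a, Real.exp ((q (x, a) - refValue πref q x) / τ) ∂(πref x))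
      (𝓝[>] 0) (𝓝 ((πref x).real (optActions πref q x))) := by
  have hqx : Measurable fun a => q (x, a) := (hq.prodMk_left x).1
  have hle : ∀ᵐ a ∂(πref x), q (x, a) ≤ refValue πref q x :=
    ae_le_essSup_of_bounded (hq.prodMk_left x).2
  rw [← integral_indicator_one (measurableSet_optActions hq x)]
  refine tendsto_integral_filter_of_dominated_convergence (fun _ => 1)
    (.of_forall fun τ => (((hqx.sub_const _).div_const τ).exp).aestronglyMeasurable) ?_
    (integrable_const _) ?_
  · filter_upwards [self_mem_nhdsWithin] with τ hτ
    filter_upwards [hle] with a ha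
    rw [Real.norm_of_nonneg (Real.exp_pos _).le, Real.exp_le_one_iff]
    exact div_nonpos_of_nonpos_of_nonneg (sub_nonpos.2 ha) (le_of_lt hτ)
  · filter_upwards [hle] with a ha
    rcases ha.eq_or_lt with hmax | hlt
    · have hmem : a ∈ optActions πref q x := hmax
      simp [hmem, hmax]
    · have hnmem : a ∉ optActions πref q x := hlt.ne
      rw [Set.indicator_of_notMem hnmem]
      simp_rw [div_eq_mul_inv]
      exact Real.tendsto_exp_atBot.comp
        (tendsto_inv_nhdsGT_zero.const_mul_atTop_of_neg (sub_neg.2 hlt))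

theorem exp_refValue_sub_softValue_div (hq : BddMeasurable q) (hτ : 0 < τ) (x : X) :
    Real.exp ((refValue πref q x - softValue πref τ q x) / τ)
      = (∫ a, Real.exp ((q (x, a) - refValue πref q x) / τ) ∂(πref x))⁻¹ := by
  simp_rw [sub_div, Real.exp_sub]
  rw [exp_softValue_div hq hτ, integral_div, inv_div]

theorem tendsto_overlap (hq : BddMeasurable q) (hpos : πref x (optActions πref q x) ≠ 0)
    {η : ℝ → ℝ} (hη : Tendsto (fun τ => η τ / τ) (𝓝[>] 0) (𝓝 0)) :
    Tendsto (fun τ => overlap πref τ (η τ) q x) (𝓝[>] 0) (𝓝 1) := by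
  have hmass : (πref x).real (optActions πref q x) ≠ 0 :=
    ENNReal.toReal_ne_zero.2 ⟨hpos, measure_ne_top _ _⟩
  have hshift : Tendsto (fun τ => Real.exp (-2 * (η τ / τ))) (𝓝[>] 0) (𝓝 1) := by
    simpa using (hη.const_mul (-2)).rexp
  have hpartition := ((tendsto_integral_exp_sub_refValue hq x).inv₀ hmass).mul_const
    ((πref x).real (optActions πref q x))
  have hlim := tendsto_real_toNNReal (hshift.mul hpartition)
  rw [inv_mul_cancel₀ hmass, mul_one, Real.toNNReal_one] at hlim
  refine hlim.congr' ?_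
  filter_upwards [self_mem_nhdsWithin] with τ hτ
  rw [overlap, ← mul_assoc, ← exp_refValue_sub_softValue_div hq hτ, ← Real.exp_add]
  ring_nf

end FilteredPolicy

section Evaluation

variable (M : MDP X A) {πref : Kernel X A} [IsMarkovKernel πref] {p B R Q c η τ : ℝ} {m : ℝ≥0∞}
  {ζ : Kernel (X × A) ℝ}

theorem isMarkovKernel_optFilteredPolicy (hc : 0 < c)
    (hcov : IsCovered πref c (M.qRef πref)) : IsMarkovKernel (M.optFilteredPolicy πref) :=
  isMarkovKernel_filteredPolicy (M.qRef_spec πref).1 (hcov.measure_ne_zero hc)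

theorem abs_discount_mul_klCost_boltzmann_le (hτ : 0 < τ) (hc : 0 < c)
    (hcov : IsCovered πref c (M.qRef πref)) {q : X × A → ℝ} (hq : BddMeasurable q)
    (hη : ∀ s, |q s - M.qRef πref s| ≤ η) (x : X) :
    |M.γ * klCost πref τ (boltzmann πref τ q) x| ≤ M.γ * softSlack c τ η := by
  rw [abs_mul, abs_of_pos M.γ_pos, abs_of_nonneg (klCost_nonneg hτ _ _ _)]
  exact mul_le_mul_of_nonneg_left
    (klCost_boltzmann_le_softSlack hq (M.qRef_spec πref).1 hη hτ hc hcov x) M.γ_pos.le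

theorem wass_iterate_softEval_boltzmann_returnDist_le (hp : 1 ≤ p) (hτ : 0 < τ) (hc : 0 < c)
    (hcov : IsCovered πref c (M.qRef πref)) (hm : m ≠ ⊤) (hR : ∀ s, |M.r s| ≤ R)
    (hB : R + M.γ * (2 * Q) ≤ (1 - M.γ) * B) (hζ : HasExcessBound p B m ζ)
    (hQ : ∀ s, |meanFn ζ s| ≤ Q) (hη : ∀ s, |meanFn ζ s - M.qRef πref s| ≤ η)
    (n : ℕ) (s : X × A) :
    wass p ((M.softEval πref τ (boltzmann πref τ (meanFn ζ)))^[n] ζ s)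
        (M.returnDist (M.optFilteredPolicy πref) s)
      ≤ ENNReal.ofReal (M.γ * softSlack c τ η / (1 - M.γ))
        + ENNReal.ofReal M.γ ^ n * (2 * ENNReal.ofReal B + 2 * m)
        + 2 * ENNReal.ofReal B * (1 - survival (M.stepKernel (M.optFilteredPolicy πref))
            (fun s' => overlap πref τ η (M.qRef πref) s'.1) n s) ^ (1 / p) := by
  have hγ : 0 < 1 - M.γ := sub_pos.2 M.γ_lt_one
  have hη0 := (abs_nonneg _).trans (hη s)
  have hslack := hcov.softSlack_nonneg hc hτ hη0 s.1
  have hRB : R / (1 - M.γ) ≤ B := by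
    rw [div_le_iff₀ hγ]
    nlinarith [M.γ_pos, (abs_nonneg _).trans (hQ s)]
  have hB0 : 0 ≤ B := (div_nonneg ((abs_nonneg _).trans (hR s)) hγ.le).trans hRB
  obtain ⟨href, -⟩ := M.qRef_spec πref
  have hq := (hζ.hasBoundedMoment hp hB0 hm).bddMeasurable_meanFn hp
  have hpos := hcov.measure_ne_zero hc
  have := M.isMarkovKernel_optFilteredPolicy hc hcov
  have := isMarkovKernel_boltzmann (πref := πref) hq hτ
  have hcost (x) := (M.abs_discount_mul_klCost_boltzmann_le hτ hc hcov hq hη x).trans_eq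
    (mul_div_cancel₀ (M.γ * softSlack c τ η) hγ.ne').symm
  have hiterate := M.hasExcessBound_iterate_softEval_boltzmann (πref := πref) (by linarith) hq hQ
    hτ hR hB hζ n
  have heval : M.softEval πref τ (boltzmann πref τ (meanFn ζ))
      = randomUpdate (M.stepKernel (boltzmann πref τ (meanFn ζ)))
        (M.costUpdate (klCost πref τ (boltzmann πref τ (meanFn ζ)))) :=
    funext (M.softEval_eq_randomUpdate πref τ _)
  rw [heval] at hiterate ⊢
  refine (M.wass_iterate_randomUpdate_returnDist_le
    (πs := M.optFilteredPolicy πref) hp (bddMeasurable_klCost_boltzmann hq hτ).1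
    (measurable_overlap href hτ η) (overlap_le_one href hτ hη0 hpos)
    (fun x => overlap_smul_filteredPolicy_le href hq hτ hη (hpos x)) hcost
    (div_nonneg (mul_nonneg M.γ_pos.le hslack) hγ.le) hB0 hR hRB hζ hiterate s).trans_eq ?_
  ring

end Evaluation

end MDP

theorem tendsto_lintegral_rpow_of_bounded {Y ι : Type*} [MeasurableSpace Y] (ϖ : Measure Y)
    [IsProbabilityMeasure ϖ] {l : Filter ι} [l.IsCountablyGenerated] {r : ℝ} (hr : 0 < r)
    {F : ι → Y → ℝ≥0∞} {g C : ℝ≥0∞} (hC : C ≠ ⊤) (hF : ∀ᶠ i in l, Measurable (F i))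
    (hbound : ∀ᶠ i in l, ∀ y, F i y ≤ C) (hlim : ∀ y, Tendsto (fun i => F i y) l (𝓝 g)) :
    Tendsto (fun i => (∫⁻ y, F i y ^ r ∂ϖ) ^ (1 / r)) l (𝓝 g) := by
  have hint : Tendsto (fun i => ∫⁻ y, F i y ^ r ∂ϖ) l (𝓝 (∫⁻ _, g ^ r ∂ϖ)) := by
    refine tendsto_lintegral_filter_of_dominated_convergence (fun _ => C ^ r)
      (hF.mono fun i hi => hi.pow_const r)
      (hbound.mono fun i hi => ae_of_all _ fun y => ENNReal.rpow_le_rpow (hi y) hr.le) ?_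
      (ae_of_all _ fun y => (hlim y).ennrpow_const r)
    simpa using ENNReal.rpow_ne_top_of_nonneg hr.le hC
  simpa [← ENNReal.rpow_mul, mul_inv_cancel₀ hr.ne'] using hint.ennrpow_const (1 / r)

theorem tendsto_lintegral_rpow_add_mul_one_sub {Y ι : Type*} [MeasurableSpace Y] (ϖ : Measure Y)
    [IsProbabilityMeasure ϖ] {l : Filter ι} [l.IsCountablyGenerated] {r t : ℝ} (hr : 0 < r)
    (ht : 0 < t) {e : ι → ℝ≥0∞} (he : Tendsto e l (𝓝 0)) {K b : ℝ≥0∞} (hK : K ≠ ⊤) (hb : b ≠ ⊤)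
    {u : ι → Y → ℝ≥0∞} (hu : ∀ᶠ i in l, Measurable (u i))
    (hlim : ∀ y, Tendsto (fun i => u i y) l (𝓝 1)) :
    Tendsto (fun i => (∫⁻ y, (e i + K + b * (1 - u i y) ^ t) ^ r ∂ϖ) ^ (1 / r)) l (𝓝 K) := by
  refine tendsto_lintegral_rpow_of_bounded ϖ hr (C := 1 + K + b) (by finiteness)
    (hu.mono fun i hi => by fun_prop) ?_ fun y => ?_
  · filter_upwards [he.eventually (ge_mem_nhds one_pos)] with i hi y
    exact add_le_add (by gcongr)
      (mul_le_of_le_one_right zero_le (ENNReal.rpow_le_one tsub_le_self ht.le))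
  · have hpow : Tendsto (fun i => (1 - u i y) ^ t) l (𝓝 0) := by
      simpa [ht] using (ENNReal.Tendsto.sub tendsto_const_nhds (hlim y)
        (Or.inl ENNReal.one_ne_top)).ennrpow_const t
    simpa using (he.add_const K).add (ENNReal.Tendsto.const_mul hpow (Or.inr hb))

theorem avgWass_le_lintegral_rpow {Y : Type*} [MeasurableSpace Y] {p r : ℝ} (hr : 0 < r)
    (ϖ : Measure Y) {ζ ζ' : Kernel Y ℝ} {F : Y → ℝ≥0∞} (h : ∀ y, wass p (ζ y) (ζ' y) ≤ F y) :
    avgWass p r ϖ ζ ζ' ≤ (∫⁻ y, F y ^ r ∂ϖ) ^ (1 / r) := by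
  refine ENNReal.rpow_le_rpow (lintegral_mono fun y => ?_) (by positivity)
  exact ENNReal.rpow_le_rpow (h y) hr.le

theorem tendsto_zero_of_tendsto_div_id {η : ℝ → ℝ}
    (hη : Tendsto (fun τ => η τ / τ) (𝓝[>] 0) (𝓝 0)) : Tendsto η (𝓝[>] 0) (𝓝 0) := by
  have hid : Tendsto (fun τ : ℝ => τ) (𝓝[>] 0) (𝓝 0) := nhdsWithin_le_nhds
  have hmul := hη.mul hid
  rw [mul_zero] at hmul
  refine hmul.congr' ?_
  filter_upwards [self_mem_nhdsWithin] with τ hτ using div_mul_cancel₀ _ (ne_of_gt hτ)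

namespace MDP

variable {X A : Type*} [MeasurableSpace X] [MeasurableSpace A]

theorem IsRefOptimal.mono {M : MDP X A} {πref π : Kernel X A} {ε ε' : ℝ}
    (h : M.IsRefOptimal πref ε π) (hε : ε ≤ ε') : M.IsRefOptimal πref ε' π :=
  ⟨h.1, fun s => (by linarith : M.qRef πref s - ε' ≤ M.qRef πref s - ε).trans (h.2 s)⟩

theorem tendsto_softSlack (c : ℝ) {η : ℝ → ℝ} (hη : Tendsto η (𝓝[>] 0) (𝓝 0)) :
    Tendsto (fun τ => softSlack c τ (η τ)) (𝓝[>] 0) (𝓝 0) := by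
  have hid : Tendsto (fun τ : ℝ => τ) (𝓝[>] 0) (𝓝 0) := nhdsWithin_le_nhds
  simpa [softSlack] using (hid.mul_const (Real.log c⁻¹)).add (hη.const_mul 2)

theorem exists_bounds (M : MDP X A) {q : X × A → ℝ} (hq : BddMeasurable q) :
    ∃ R Q B : ℝ, (∀ s, |M.r s| ≤ R) ∧ (∀ s, |q s| ≤ Q) ∧ R + M.γ * Q ≤ Q ∧ 0 ≤ B ∧
      R + M.γ * (2 * Q) ≤ (1 - M.γ) * B := by
  obtain ⟨R, hR⟩ := M.bddMeasurable_r.2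
  obtain ⟨C, hC⟩ := hq.2
  have hγ : 0 < 1 - M.γ := sub_pos.2 M.γ_lt_one
  have hγ0 := M.γ_pos
  refine ⟨|R|, |C| + |R| / (1 - M.γ), (|R| + M.γ * (2 * (|C| + |R| / (1 - M.γ)))) / (1 - M.γ),
    fun s => (hR s).trans (le_abs_self R), fun s => ?_, ?_, by positivity, ?_⟩
  · have : 0 ≤ |R| / (1 - M.γ) := by positivity
    linarith [hC s, le_abs_self C]
  · have hcancel : (1 - M.γ) * (|R| / (1 - M.γ)) = |R| := mul_div_cancel₀ _ hγ.ne'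
    nlinarith [abs_nonneg C]
  · rw [mul_div_cancel₀ _ hγ.ne']

theorem exists_pow_discount_mul_lt (M : MDP X A) {a δ : ℝ≥0∞} (ha : a ≠ ⊤) (hδ : 0 < δ) :
    ∃ n : ℕ, ENNReal.ofReal M.γ ^ n * a < δ := by
  have hlim : Tendsto (fun n : ℕ => ENNReal.ofReal M.γ ^ n * a) atTop (𝓝 0) := by
    simpa using ENNReal.Tendsto.mul_const (ENNReal.tendsto_pow_atTop_nhds_zero_of_lt_one
      (by simpa using M.γ_lt_one)) (Or.inr ha)
  exact (hlim.eventually (gt_mem_nhds hδ)).exists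

section VanishingTemperature

variable (M : MDP X A) {πref : Kernel X A} [IsMarkovKernel πref] {p p' B R Q c ε : ℝ} {m : ℝ≥0∞}
  {η : ℝ → ℝ}

theorem tendsto_survival_overlap (hc : 0 < c) (hcov : IsCovered πref c (M.qRef πref))
    (hη0 : ∀ τ, 0 < τ → 0 ≤ η τ) (hητ : Tendsto (fun τ => η τ / τ) (𝓝[>] 0) (𝓝 0)) (n : ℕ)
    (s : X × A) :
    Tendsto (fun τ => survival (M.stepKernel (M.optFilteredPolicy πref))
      (fun s' => overlap πref τ (η τ) (M.qRef πref) s'.1) n s) (𝓝[>] 0) (𝓝 1) := by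
  obtain ⟨href, -⟩ := M.qRef_spec πref
  have hpos := hcov.measure_ne_zero hc
  have := M.isMarkovKernel_optFilteredPolicy hc hcov
  have := M.isMarkovKernel_stepKernel (M.optFilteredPolicy πref)
  refine tendsto_survival (w := fun τ (s' : X × A) => overlap πref τ (η τ) (M.qRef πref) s'.1)
    _ ?_ ?_ (fun s' => tendsto_overlap href (hpos s'.1) hητ) n s
  · filter_upwards [self_mem_nhdsWithin] with τ hτ
    exact (measurable_overlap href hτ _).comp measurable_fst
  · filter_upwards [self_mem_nhdsWithin] with τ hτ s'
    exact overlap_le_one href hτ (hη0 τ hτ) hpos s'.1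

theorem eventually_avgWass_iterate_softEval_boltzmann_le (hp : 1 ≤ p) (hp' : 0 < p')
    (ϖ : Measure (X × A)) [IsProbabilityMeasure ϖ] (hc : 0 < c)
    (hcov : IsCovered πref c (M.qRef πref)) (hm : m ≠ ⊤) (hR : ∀ s, |M.r s| ≤ R)
    (hB : R + M.γ * (2 * Q) ≤ (1 - M.γ) * B) (hη0 : ∀ τ, 0 < τ → 0 ≤ η τ)
    (hητ : Tendsto (fun τ => η τ / τ) (𝓝[>] 0) (𝓝 0)) {n : ℕ} {δ : ℝ≥0∞}
    (hn : ENNReal.ofReal M.γ ^ n * (2 * ENNReal.ofReal B + 2 * m) < δ) :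
    ∀ᶠ τ in 𝓝[>] 0, ∀ ζ : Kernel (X × A) ℝ, HasExcessBound p B m ζ → (∀ s, |meanFn ζ s| ≤ Q) →
      (∀ s, |meanFn ζ s - M.qRef πref s| ≤ η τ) →
      avgWass p p' ϖ ((M.softEval πref τ (boltzmann πref τ (meanFn ζ)))^[n] ζ)
        (M.returnDist (M.optFilteredPolicy πref)) ≤ δ := by
  have := M.isMarkovKernel_optFilteredPolicy hc hcov
  have := M.isMarkovKernel_stepKernel (M.optFilteredPolicy πref)
  have hcost : Tendsto (fun τ => ENNReal.ofReal (M.γ * softSlack c τ (η τ) / (1 - M.γ)))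
      (𝓝[>] 0) (𝓝 0) := by
    simpa using ENNReal.tendsto_ofReal (((tendsto_softSlack c
      (tendsto_zero_of_tendsto_div_id hητ)).const_mul M.γ).div_const (1 - M.γ))
  have hmeas : ∀ᶠ τ in 𝓝[>] 0, Measurable (survival (M.stepKernel (M.optFilteredPolicy πref))
      (fun s => overlap πref τ (η τ) (M.qRef πref) s.1) n) := by
    filter_upwards [self_mem_nhdsWithin] with τ hτ
    exact measurable_survival _
      ((measurable_overlap (M.qRef_spec πref).1 hτ _).comp measurable_fst) n
  have hlim := tendsto_lintegral_rpow_add_mul_one_sub ϖ hp' (by positivity : 0 < 1 / p) hcost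
    (hn.ne_top) (by finiteness : 2 * ENNReal.ofReal B ≠ ⊤) hmeas
    (M.tendsto_survival_overlap hc hcov hη0 hητ n)
  filter_upwards [hlim.eventually (gt_mem_nhds hn), self_mem_nhdsWithin]
    with τ hτδ hτ ζ hζ hQ hη
  exact (avgWass_le_lintegral_rpow hp' ϖ fun s =>
    M.wass_iterate_softEval_boltzmann_returnDist_le hp hτ hc hcov hm hR hB hζ hQ hη n s).trans
      hτδ.le

theorem eventually_isRefOptimal_boltzmann_iterate_softEval (hp : 1 ≤ p) (hc : 0 < c)
    (hcov : IsCovered πref c (M.qRef πref)) (hB0 : 0 ≤ B) (hm : m ≠ ⊤) (hR : ∀ s, |M.r s| ≤ R)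
    (hB : R + M.γ * (2 * Q) ≤ (1 - M.γ) * B)
    (hη : Tendsto η (𝓝[>] 0) (𝓝 0)) (hε : 0 < ε) :
    ∀ᶠ τ in 𝓝[>] 0, ∀ ζ : Kernel (X × A) ℝ, HasExcessBound p B m ζ → (∀ s, |meanFn ζ s| ≤ Q) →
      (∀ s, |meanFn ζ s - M.qRef πref s| ≤ η τ) → ∀ n,
      M.IsRefOptimal πref ε (boltzmann πref τ
        (meanFn ((M.softEval πref τ (boltzmann πref τ (meanFn ζ)))^[n] ζ))) := by
  have hgap := (tendsto_softSlack c hη).div_const (1 - M.γ)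
  rw [zero_div] at hgap
  have hloss := ((tendsto_softSlack c hgap).const_mul M.γ).div_const (1 - M.γ)
  rw [mul_zero, zero_div] at hloss
  filter_upwards [hloss.eventually (ge_mem_nhds hε), self_mem_nhdsWithin] with τ hτε hτ ζ hζ hQ
    hnear n
  have hq := (hζ.hasBoundedMoment hp hB0 hm).bddMeasurable_meanFn hp
  have hmoment := (M.hasExcessBound_iterate_softEval_boltzmann (πref := πref) (by linarith) hq hQ
    hτ hR hB hζ n).hasBoundedMoment hp hB0 (by finiteness)
  exact (M.isRefOptimal_boltzmann hτ hc hcov (hmoment.bddMeasurable_meanFn hp)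
    (M.abs_meanFn_iterate_softEval_boltzmann_sub_qRef_le hτ hc hcov hp hB0 hm hR hB hζ hQ hnear
      n)).mono hτε

end VanishingTemperature

end MDP

theorem mainTheorem3_general {X A : Type*} [MeasurableSpace X] [MeasurableSpace A]
    (M : MDP X A) (πref : Kernel X A) [IsMarkovKernel πref] (hcov : M.Coverage πref)
    (p p' : ℝ) (hp : 1 ≤ p) (hp' : 0 < p')
    (ϖ : Measure (X × A)) [IsProbabilityMeasure ϖ]
    (ε δ : ℝ) (hε : 0 < ε) (hδ : 0 < δ)
    (ζ₀ : Kernel (X × A) ℝ) (hζ₀ : HasBoundedMoment p ζ₀)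
    (σ : ℝ → ℝ) (hσ : IsDecoupling σ) :
    ∃ τ : ℝ, 0 < τ ∧ ∃ nOpt nEval : ℕ,
      avgWass p p' ϖ (M.decoupledIterate πref τ (σ τ) ζ₀ nOpt nEval)
          (M.returnDist (M.optFilteredPolicy πref)) ≤ ENNReal.ofReal δ ∧
      M.IsRefOptimal πref ε
        (MDP.boltzmann πref τ (meanFn (M.decoupledIterate πref τ (σ τ) ζ₀ nOpt nEval))) := by
  obtain ⟨c, hc, hsoft⟩ := hcov
  obtain ⟨hσ0, hστ⟩ := hσ
  have hcov := M.isCovered_qRef hc hsoft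
  obtain ⟨s₀⟩ := nonempty_of_isProbabilityMeasure ϖ
  obtain ⟨R, Q, B, hR, hQ, hQR, hB0, hB⟩ := M.exists_bounds (hζ₀.bddMeasurable_meanFn hp)
  obtain ⟨m, hm, hexcess⟩ := hζ₀.exists_hasExcessBound (by linarith)
  obtain ⟨nEval, hnEval⟩ := M.exists_pow_discount_mul_lt
    (by finiteness : 2 * ENNReal.ofReal B + 2 * m ≠ ⊤) (ENNReal.ofReal_pos.2 hδ)
  set C := 1 + M.γ * Real.log c⁻¹ / (1 - M.γ)
  have hC : 0 ≤ C := add_nonneg zero_le_one (div_nonneg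
    (mul_nonneg M.γ_pos.le (hcov.log_inv_nonneg hc s₀.1)) (sub_nonneg.2 M.γ_lt_one.le))
  have hητ : Tendsto (fun τ => C * σ τ / τ) (𝓝[>] 0) (𝓝 0) := by
    simpa [mul_div_assoc] using hστ.const_mul C
  have hclose := M.eventually_avgWass_iterate_softEval_boltzmann_le hp hp' ϖ hc hcov hm hR hB
    (fun τ hτ => mul_nonneg hC (hσ0 τ hτ).le) hητ hnEval
  have hoptimal := M.eventually_isRefOptimal_boltzmann_iterate_softEval hp hc hcov hB0 hm hR hB
    (tendsto_zero_of_tendsto_div_id hητ) hε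
  obtain ⟨τ, hτclose, hτoptimal, hτ⟩ :=
    (hclose.and (hoptimal.and eventually_mem_nhdsWithin)).exists
  obtain ⟨nOpt, hnear⟩ := M.exists_abs_meanFn_controlIterate_sub_qRef_le hp (hσ0 τ hτ) hR hQR
    hB0 hB hm (hexcess B hB0) hQ hc (hsoft _ (hσ0 τ hτ))
  obtain ⟨hζ, hζQ⟩ := M.controlIterate_bounds (πref := πref) hp (hσ0 τ hτ) hR hQR hB0 hB hm
    (hexcess B hB0) hQ nOpt
  exact ⟨τ, hτ, nOpt, nEval, hτclose _ hζ hζQ hnear, hτoptimal _ hζ hζQ hnear nEval⟩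

theorem mainTheorem3 {X A : Type*} [MeasurableSpace X] [StandardBorelSpace X]
    [MeasurableSpace A] [Countable A] [DiscreteMeasurableSpace A]
    (M : MDP X A) (πref : Kernel X A) [IsMarkovKernel πref] (hcov : M.Coverage πref)
    (p p' : ℝ) (hp : 1 ≤ p) (hp' : 1 ≤ p')
    (ϖ : Measure (X × A)) [IsProbabilityMeasure ϖ]
    (ε δ : ℝ) (hε : 0 < ε) (hδ : 0 < δ)
    (ζ₀ : Kernel (X × A) ℝ) (hζ₀ : HasBoundedMoment p ζ₀)
    (σ : ℝ → ℝ) (hσ : IsDecoupling σ) :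
    ∃ τ : ℝ, 0 < τ ∧ ∃ nOpt nEval : ℕ,
      avgWass p p' ϖ (M.decoupledIterate πref τ (σ τ) ζ₀ nOpt nEval)
          (M.returnDist (M.optFilteredPolicy πref)) ≤ ENNReal.ofReal δ ∧
      M.IsRefOptimal πref ε
        (MDP.boltzmann πref τ (meanFn (M.decoupledIterate πref τ (σ τ) ζ₀ nOpt nEval))) :=
  mainTheorem3_general M πref hcov p p' hp (by linarith) ϖ ε δ hε hδ ζ₀ hζ₀ σ hσ
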